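/- Let $d\in\mathbb{N}$, $Y=[0,2\pi)^d$, $\mathcal{M}_Y(f)=\frac{1}{|Y|}\int_Y f\,dy$, and let $A=(a_{jk})_{j,k=1}^d$ be a matrix of real, bounded, measurable functions on $\mathbb{R}^d$ that is symmetric, $Y$-periodic ($A(y+2\pi p)=A(y)$ for $p\in\mathbb{Z}^d$) and elliptic: there is $\alpha>0$ with $A(y)\xi\cdot\xi\ge\alpha|\xi|^2$ for all $\xi\in\mathbb{R}^d$ and a.e. $y$. Let $H^2_\sharp(Y)$ be the space of complex-valued $Y$-periodic $H^2$ functions. Fix $\rho>0$ and, for $\eta\in\mathbb{R}^d$ and $u,v\in H^2_\sharp(Y)$, put $$a^\rho[\eta](u,v)=\int_Y A(\nabla+i\eta)u\cdot\overline{(\nabla+i\eta)v}\,dy+\rho^2\int_Y(\nabla+i\eta)^2u\,\overline{(\nabla+i\eta)^2v}\,dy .$$ A real number $\mu$ is a Bloch eigenvalue of $\rho^2\Delta^2-\nabla\cdot A\nabla$ at $\eta$, with eigenfunction $0\ne u\in H^2_\sharp(Y)$, if $a^\rho[\eta](u,v)=\mu\int_Y u\overline v\,dy$ for all $v\in H^2_\sharp(Y)$;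 $\lambda_1^\rho(\eta)$ denotes the smallest Bloch eigenvalue at $\eta$. For $1\le l\le d$ let $\chi_l^\rho\in H^2_\sharp(Y)$ be the weak solution of the cell problem $$\rho^2\Delta^2\chi_l^\rho-\operatorname{div}A(e_l+\nabla\chi_l^\rho)=0,\qquad \mathcal{M}_Y(\chi_l^\rho)=0,$$ and let $A^{\rho,\mathrm{hom}}=\mathcal{M}_Y(A+A\nabla\chi^\rho)$, i.e. $A^{\rho,\mathrm{hom}}_{kl}=\mathcal{M}_Y\big(a_{kl}+\sum_j a_{kj}\,\partial_{y_j}\chi_l^\rho\big)$. Then each $\chi_l^\rho$ exists and is unique, and there is $\delta>0$ such that for $|\eta|<\delta$ the smallest eigenvalue $\lambda_1^\rho(\eta)$ exists and is a real-analytic function of $\eta$, with an eigenfunction $\phi_1^\rho(\cdot;\eta)\in H^2_\sharp(Y)$ normalized by $\mathcal{M}_Y(\phi_1^\rho(\cdot;\eta))=(2\pi)^{-d/2}$ and depending analytically on $\eta$ as an element of $H^2_\sharp(Y)$. Moreover: 1. $\lambda_1^\rho(0)=0$. 2. $\frac{\partial\lambda_1^\rho}{\partial\eta_l}(0)=0$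 for $l=1,\dots,d$. 3. For every such normalized analytic choice of $\phi_1^\rho$ near $\eta=0$ and every $l=1,\dots,d$, the function $y\mapsto\frac{\partial\phi_1^\rho}{\partial\eta_l}(y;0)-i\,\phi_1^\rho(y;0)\,\chi_l^\rho(y)$ is (a.e.) constant. 4. $\frac12\frac{\partial^2\lambda_1^\rho}{\partial\eta_k\partial\eta_l}(0)=e_k\cdot A^{\rho,\mathrm{hom}}e_l$ for all $k,l=1,\dots,d$. -/

import Mathlib

open MeasureTheory
open scoped ComplexConjugate ENNReal

noncomputable section

namespace BlochWave

/-- The basic periodicity cell `Y = [0, 2π)^d`, parametrizing the torus. -/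
def cell (d : ℕ) : Set (Fin d → ℝ) :=
  Set.pi Set.univ fun _ => Set.Ico 0 (2 * Real.pi)

/-- The space `L²_♯(Y)` of complex-valued `Y`-periodic `L²` functions; a periodic function is
given by its restriction to the cell `Y`. -/
abbrev L2 (d : ℕ) : Type :=
  Lp ℂ 2 ((volume : Measure (Fin d → ℝ)).restrict (cell d))

/-- The mean value `M_Y(f) = |Y|⁻¹ ∫_Y f`. -/
def cellMean {d : ℕ} (f : (Fin d → ℝ) → ℂ) : ℂ :=
  ⨍ y in cell d, f y

/-- The Fourier mode `y ↦ exp (i n · y)`. -/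
def fourierMode {d : ℕ} (n : Fin d → ℤ) (y : Fin d → ℝ) : ℂ :=
  Complex.exp (Complex.I * ∑ j, (n j : ℂ) * (y j : ℂ))

/-- The Fourier coefficient `û(n) = |Y|⁻¹ ∫_Y u(y) exp (-i n · y) dy`. -/
def fourierCoeff {d : ℕ} (u : L2 d) (n : Fin d → ℤ) : ℂ :=
  cellMean fun y => u y * conj (fourierMode n y)

/-- `g` is the distributional derivative `∂u/∂y_j` of `u` as a periodic distribution,
i.e. `ĝ(n) = i n_j û(n)` for every `n ∈ ℤ^d`. -/
def IsPartialDeriv {d : ℕ} (j : Fin d) (u g : L2 d) : Prop :=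
  ∀ n : Fin d → ℤ, fourierCoeff g n = Complex.I * (n j : ℂ) * fourierCoeff u n

theorem volume_cell_lt_top (d : ℕ) : (volume : Measure (Fin d → ℝ)) (cell d) < ∞ := by
  rw [cell, Real.volume_pi_Ico]
  exact ENNReal.prod_lt_top fun _ _ => ENNReal.ofReal_lt_top

instance (d : ℕ) : IsFiniteMeasure ((volume : Measure (Fin d → ℝ)).restrict (cell d)) :=
  isFiniteMeasure_restrict.mpr (volume_cell_lt_top d).ne

theorem continuous_fourierMode {d : ℕ} (n : Fin d → ℤ) : Continuous (fourierMode n) := by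
  unfold fourierMode
  fun_prop

theorem norm_fourierMode {d : ℕ} (n : Fin d → ℤ) (y : Fin d → ℝ) : ‖fourierMode n y‖ = 1 := by
  have h : Complex.I * ∑ j, (n j : ℂ) * (y j : ℂ)
      = ((∑ j, (n j : ℝ) * y j : ℝ) : ℂ) * Complex.I := by
    push_cast
    ring
  rw [fourierMode, h, Complex.norm_exp_ofReal_mul_I]

theorem integrable_mul_fourierMode {d : ℕ} (u : L2 d) (n : Fin d → ℤ) :
    Integrable (fun y => u y * conj (fourierMode n y)) (volume.restrict (cell d)) := by
  have hu : Integrable (fun y => u y) (volume.restrict (cell d)) :=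
    (Lp.memLp u).integrable (by norm_num)
  refine hu.mul_bdd (c := 1) ?_ ?_
  · exact (Complex.continuous_conj.comp (continuous_fourierMode n)).aestronglyMeasurable
  · exact Filter.Eventually.of_forall fun y => by simp [norm_fourierMode]

theorem fourierCoeff_add {d : ℕ} (u v : L2 d) (n : Fin d → ℤ) :
    fourierCoeff (u + v) n = fourierCoeff u n + fourierCoeff v n := by
  simp only [fourierCoeff, cellMean, setAverage_eq]
  rw [← smul_add, ← integral_add (integrable_mul_fourierMode u n) (integrable_mul_fourierMode v n)]
  congr 1
  refine integral_congr_ae ?_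
  filter_upwards [Lp.coeFn_add u v] with y hy
  rw [hy, Pi.add_apply, add_mul]

theorem fourierCoeff_smul {d : ℕ} (c : ℂ) (u : L2 d) (n : Fin d → ℤ) :
    fourierCoeff (c • u) n = c * fourierCoeff u n := by
  simp only [fourierCoeff, cellMean, setAverage_eq]
  rw [mul_smul_comm, ← integral_const_mul]
  congr 1
  refine integral_congr_ae ?_
  filter_upwards [Lp.coeFn_smul c u] with y hy
  rw [hy, Pi.smul_apply, smul_eq_mul, mul_assoc]

theorem fourierCoeff_zero {d : ℕ} (n : Fin d → ℤ) : fourierCoeff (0 : L2 d) n = 0 := by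
  simpa using fourierCoeff_smul 0 (0 : L2 d) n

/-- Index set for the derivatives of order at most two: `u`, `∂_j u` and `∂_j ∂_k u`. -/
abbrev JetIndex (d : ℕ) : Type := Unit ⊕ Fin d ⊕ (Fin d × Fin d)

/-- `H²_♯(Y)` as the space of all `(u, ∂_j u, ∂_j ∂_k u)` in `L²_♯(Y)`, with the norm
`(‖u‖² + ∑_j ‖∂_j u‖² + ∑_{j,k} ‖∂_j ∂_k u‖²)^{1/2}`. -/
def sobolevH2 (d : ℕ) : Submodule ℂ (PiLp 2 fun _ : JetIndex d => L2 d) where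
  carrier := {w | (∀ j, IsPartialDeriv j (w (.inl ())) (w (.inr (.inl j)))) ∧
    ∀ j k, IsPartialDeriv k (w (.inr (.inl j))) (w (.inr (.inr (j, k))))}
  add_mem' := by
    rintro w z ⟨hw, hw'⟩ ⟨hz, hz'⟩
    refine ⟨fun j n => ?_, fun j k n => ?_⟩
    · rw [PiLp.add_apply, PiLp.add_apply, fourierCoeff_add, fourierCoeff_add, hw j n, hz j n]
      ring
    · rw [PiLp.add_apply, PiLp.add_apply, fourierCoeff_add, fourierCoeff_add, hw' j k n, hz' j k n]
      ring
  zero_mem' := by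
    refine ⟨fun j n => ?_, fun j k n => ?_⟩ <;>
    · rw [PiLp.zero_apply, PiLp.zero_apply, fourierCoeff_zero, mul_zero]
  smul_mem' := by
    rintro c w ⟨hw, hw'⟩
    refine ⟨fun j n => ?_, fun j k n => ?_⟩
    · rw [PiLp.smul_apply, PiLp.smul_apply, fourierCoeff_smul, fourierCoeff_smul, hw j n]
      ring
    · rw [PiLp.smul_apply, PiLp.smul_apply, fourierCoeff_smul, fourierCoeff_smul, hw' j k n]
      ring

/-- The Hilbert space `H²_♯(Y)`. -/
abbrev H2 (d : ℕ) : Type := sobolevH2 d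

namespace H2

variable {d : ℕ}

/-- The underlying `L²` function of `u ∈ H²_♯(Y)`. -/
def toL2 (u : H2 d) : L2 d := u.1 (.inl ())

/-- `∂u/∂y_j`. -/
def grad (u : H2 d) (j : Fin d) : L2 d := u.1 (.inr (.inl j))

/-- `∂²u/∂y_j∂y_k`. -/
def hess (u : H2 d) (j k : Fin d) : L2 d := u.1 (.inr (.inr (j, k)))

/-- `Δu`. -/
def laplacian (u : H2 d) : L2 d := ∑ j, u.hess j j

/-- The `j`-th component `∂_j u + i η_j u` of `(∇ + iη) u`. -/
def shiftedGrad (η : EuclideanSpace ℝ (Fin d)) (u : H2 d) (j : Fin d) : L2 d :=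
  u.grad j + (Complex.I * (η j : ℂ)) • u.toL2

/-- `(∇ + iη)² u = Δu + 2 i η · ∇u - |η|² u`. -/
def shiftedLaplacian (η : EuclideanSpace ℝ (Fin d)) (u : H2 d) : L2 d :=
  u.laplacian + ∑ j, (2 * Complex.I * (η j : ℂ)) • u.grad j - ((‖η‖ ^ 2 : ℝ) : ℂ) • u.toL2

end H2

/-- A real, bounded, measurable, uniformly elliptic, `Y`-periodic and symmetric coefficient
matrix. -/
structure IsCoefficient {d : ℕ} (A : (Fin d → ℝ) → Matrix (Fin d) (Fin d) ℝ) : Prop where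
  measurable : ∀ j k, AEMeasurable (fun y => A y j k) volume
  bounded : ∃ C : ℝ, ∀ j k, ∀ᵐ y, |A y j k| ≤ C
  elliptic : ∃ α : ℝ, 0 < α ∧ ∀ᵐ y, ∀ ξ : Fin d → ℝ,
    α * ∑ j, ξ j ^ 2 ≤ ∑ j, ∑ k, A y j k * ξ k * ξ j
  periodic : ∀ p : Fin d → ℤ, ∀ᵐ y, A (fun j => y j + 2 * Real.pi * (p j : ℝ)) = A y
  symmetric : ∀ᵐ y, (A y).IsSymm

section Operator

variable {d : ℕ} (A : (Fin d → ℝ) → Matrix (Fin d) (Fin d) ℝ) (ρ : ℝ)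

/-- The form `a^ρ[η](u, v) = ∫_Y A (∇+iη)u · conj((∇+iη)v) + ρ² ∫_Y (∇+iη)²u conj((∇+iη)²v)` on
`H²_♯(Y)`, associated with the shifted operator
`A^ρ(η) = ρ² (∇+iη)⁴ - (∇+iη) · A (∇+iη)`. -/
def blochForm (η : EuclideanSpace ℝ (Fin d)) (u v : H2 d) : ℂ :=
  (∫ y in cell d, ∑ j, ∑ k,
      (A y j k : ℂ) * H2.shiftedGrad η u k y * conj (H2.shiftedGrad η v j y)) +
    (ρ : ℂ) ^ 2 * ∫ y in cell d,
      H2.shiftedLaplacian η u y * conj (H2.shiftedLaplacian η v y)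

/-- `u ∈ H²_♯(Y)` is a (weak) solution of `A^ρ(η) u = μ u`. -/
def SolvesBloch (η : EuclideanSpace ℝ (Fin d)) (μ : ℝ) (u : H2 d) : Prop :=
  ∀ v : H2 d, blochForm A ρ η u v = (μ : ℂ) * ∫ y in cell d, u.toL2 y * conj (v.toL2 y)

/-- The set of Bloch eigenvalues at the dual parameter `η`. -/
def blochEigenvalues (η : EuclideanSpace ℝ (Fin d)) : Set ℝ :=
  {μ | ∃ u : H2 d, u ≠ 0 ∧ SolvesBloch A ρ η μ u}

/-- The first (smallest) Bloch eigenvalue `λ₁^ρ(η)`. -/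
def firstBlochEigenvalue (η : EuclideanSpace ℝ (Fin d)) : ℝ :=
  sInf (blochEigenvalues A ρ η)

/-- `φ` is an analytic choice, for `|η| < δ`, of first Bloch eigenfunctions
`φ₁^ρ(·; η) ∈ H²_♯(Y)`, normalized by `M_Y(φ₁^ρ(·; η)) = (2π)^{-d/2}`. -/
structure IsFirstBlochEigenfunction (δ : ℝ) (φ : EuclideanSpace ℝ (Fin d) → H2 d) : Prop where
  analytic : AnalyticOnNhd ℝ φ (Metric.ball 0 δ)
  solves : ∀ η ∈ Metric.ball (0 : EuclideanSpace ℝ (Fin d)) δ,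
    SolvesBloch A ρ η (firstBlochEigenvalue A ρ η) (φ η)
  normalized : ∀ η ∈ Metric.ball (0 : EuclideanSpace ℝ (Fin d)) δ,
    cellMean (φ η).toL2 = (((2 * Real.pi) ^ (-(d : ℝ) / 2) : ℝ) : ℂ)

/-- `χ ∈ H²_♯(Y)` is a (weak) solution of the cell problem
`ρ² Δ² χ - div A (e_l + ∇χ) = 0`, `M_Y(χ) = 0`. -/
def SolvesCellProblem (l : Fin d) (χ : H2 d) : Prop :=
  cellMean χ.toL2 = 0 ∧ ∀ v : H2 d,
    (ρ : ℂ) ^ 2 * (∫ y in cell d, χ.laplacian y * conj (v.laplacian y)) +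
      (∫ y in cell d, ∑ j, ∑ k,
        (A y j k : ℂ) * ((if k = l then 1 else 0) + χ.grad k y) * conj (v.grad j y)) = 0

/-- The homogenized matrix `M_Y(A + A ∇χ)`, where `(∇χ)_{jl} = ∂χ_l/∂y_j`. -/
def homogenizedMatrix (χ : Fin d → H2 d) : Matrix (Fin d) (Fin d) ℂ := fun k l =>
  cellMean fun y => (A y k l : ℂ) + ∑ j, (A y k j : ℂ) * (χ l).grad j y

end Operator

/-- The partial derivative `∂f/∂η_l`. -/
def partialEta {d : ℕ} {E : Type*} [NormedAddCommGroup E] [NormedSpace ℝ E] (l : Fin d)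
    (f : EuclideanSpace ℝ (Fin d) → E) (η : EuclideanSpace ℝ (Fin d)) : E :=
  fderiv ℝ f η (EuclideanSpace.single l 1)

end BlochWave

end

open BlochWave

namespace BlochWave

noncomputable section

variable {d : ℕ} {A : (Fin d → ℝ) → Matrix (Fin d) (Fin d) ℝ} {ρ : ℝ}

/-! ### Parseval's identity on the cell -/

/-! The eigenpair near `η = 0` comes from the analytic implicit function theorem, not from spectral
theory. One unknown `z ∈ H²` encodes eigenvalue and normalized eigenfunction at once: the eigenvalue
is `-M(z)` and the eigenfunction is `c + z - M(z)`, which has mean `c` automatically. The equation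
`residual (η, z) = 0` is polynomial in its data and holds at the origin. Its `z`-derivative there is
the cell operator plus a rank-one term seeing only the mean. Parseval gives a Poincaré–Wirtinger
inequality and the identity of the norms of Hessian and Laplacian. So this operator is coercive on
`H²`, hence invertible (`isUnit_correctedOp`), and an analytic branch exists
(`exists_residual_solution`).

The branch is the bottom of the spectrum because, for small `η`, the form is at least `α/4` times
the squared `L²` norm on functions of mean zero. An eigenvalue below the branch would give two
orthogonal eigenfunctions, and their mean-zero combination would have too little energy
(`isLeast_of_solvesBloch`). No compactness or min-max principle is used.

The form is nonnegative and vanishes on constants, so `η = 0` minimizes the first eigenvalue: its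
value and gradient there are zero. Differentiating the weak equation once in direction `e_l` then
leaves the cell problem, up to the factor `i c` and an element of the kernel, which consists of
constants (`IsFirstBlochEigenfunction.partialEta_eq`).

For the Hessian, test the eigenvalue equation with `1`. As `(∇ + iη) 1 = iη`, this writes the
eigenvalue as `∑ η_j g_j(η)`. The second derivatives at `0` therefore need only first derivatives of
`g_j`, hence only the first-order eigenfunction. They are `∂_l g_j(0) = A^hom_{jl}`, and reality and
symmetry of `A^hom` finish the proof. -/

theorem norm_sq_L2 (f : L2 d) : ‖f‖ ^ 2 = ∫ y in cell d, ‖f y‖ ^ 2 := by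
  rw [← inner_self_eq_norm_sq (𝕜 := ℂ) f, L2.inner_def, ← integral_re (L2.integrable_inner f f)]
  simp [← Complex.ofReal_pow]

section Parseval

-- Parseval on `UnitAddTorus` is for the normalized Haar measure, so `volume` on the circle is set
-- to it here.
local instance : MeasureSpace UnitAddCircle := ⟨AddCircle.haarAddCircle⟩
local instance : Measure.IsAddHaarMeasure (volume : Measure UnitAddCircle) :=
  inferInstanceAs (Measure.IsAddHaarMeasure AddCircle.haarAddCircle)
local instance : IsProbabilityMeasure (volume : Measure UnitAddCircle) :=
  inferInstanceAs (IsProbabilityMeasure AddCircle.haarAddCircle)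

/-- The section of the covering map from `ℝ^d` to the torus with values in `(0, 2π]^d`. -/
def torusSection (d : ℕ) (t : UnitAddTorus (Fin d)) : Fin d → ℝ :=
  (2 * Real.pi) • (UnitAddTorus.measurableEquivPiIoc (0 : Fin d → ℝ) t).1

theorem mFourier_eq_fourierMode (n : Fin d → ℤ) (t : UnitAddTorus (Fin d)) :
    UnitAddTorus.mFourier n t = fourierMode n (torusSection d t) := by
  have h : ∀ i, fourier (n i) (t i) =
      Complex.exp (Complex.I * ((n i : ℂ) * (torusSection d t i : ℂ))) := by
    intro i
    have h1 : (((UnitAddTorus.measurableEquivPiIoc (0 : Fin d → ℝ) t).1 i : ℝ) : UnitAddCircle)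
        = t i := AddCircle.coe_equivIoc
    rw [← h1, fourier_coe_apply]
    congr 1
    simp only [torusSection, Pi.smul_apply, smul_eq_mul]
    push_cast
    ring
  rw [fourierMode, Finset.mul_sum, Complex.exp_sum]
  change ∏ i, fourier (n i) (t i) = _
  exact Finset.prod_congr rfl fun i _ => h i

/-- The factor `c` can stay unspecified: the torus has total mass one, which later forces `c` to be
the inverse volume of the cell. -/
theorem measurePreserving_torusSection (d : ℕ) :
    ∃ c : ℝ≥0∞, MeasurePreserving (torusSection d) volume (c • volume.restrict (cell d)) := by
  set S : Set (Fin d → ℝ) := {x | ∀ i, x i ∈ Set.Ioc ((0 : Fin d → ℝ) i) ((0 : Fin d → ℝ) i + 1)}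
  have hS : MeasurableSet S := by
    have : S = Set.pi Set.univ fun _ => Set.Ioc 0 1 := by
      ext x; simp [S]
    rw [this]
    exact MeasurableSet.univ_pi fun _ => measurableSet_Ioc
  have h1 := UnitAddTorus.measurePreserving_equivPiIoc (a := (0 : Fin d → ℝ))
  have h2 : MeasurePreserving (Subtype.val : S → (Fin d → ℝ)) (Measure.comap Subtype.val volume)
      (volume.restrict S) := measurePreserving_subtype_coe hS
  have hpi : (2 * Real.pi) ≠ 0 := by positivity
  have h3 : MeasurePreserving (fun x : Fin d → ℝ => (2 * Real.pi) • x) volume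
      (ENNReal.ofReal |((2 * Real.pi) ^ Module.finrank ℝ (Fin d → ℝ))⁻¹| • volume) :=
    ⟨measurable_const_smul _, Measure.map_addHaar_smul _ hpi⟩
  refine ⟨ENNReal.ofReal |((2 * Real.pi) ^ Module.finrank ℝ (Fin d → ℝ))⁻¹|, ?_⟩
  have hT : MeasurableSet (Set.pi Set.univ fun _ : Fin d => Set.Ioc (0 : ℝ) (2 * Real.pi)) :=
    MeasurableSet.univ_pi fun _ => measurableSet_Ioc
  have h4 := h3.restrict_preimage hT
  have h5 : (fun x : Fin d → ℝ => (2 * Real.pi) • x) ⁻¹'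
      (Set.pi Set.univ fun _ : Fin d => Set.Ioc (0 : ℝ) (2 * Real.pi)) = S := by
    ext x
    have hp : 0 < 2 * Real.pi := by positivity
    simp only [Set.mem_preimage, Set.mem_pi, Set.mem_univ, true_imp_iff, Pi.smul_apply,
      smul_eq_mul, Set.mem_Ioc, S, Set.mem_ofPred_eq, Pi.zero_apply, zero_add]
    refine forall_congr' fun i => and_congr ?_ ?_
    · exact mul_pos_iff_of_pos_left hp
    · exact mul_le_iff_le_one_right hp
  -- The section takes values in `(0, 2π]^d` and the cell is `[0, 2π)^d`; both agree a.e. with the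
  -- closed cube.
  have h6 : (volume : Measure (Fin d → ℝ)).restrict
      (Set.pi Set.univ fun _ : Fin d => Set.Ioc (0 : ℝ) (2 * Real.pi)) =
      volume.restrict (cell d) := by
    refine Measure.restrict_congr_set ?_
    exact (Measure.univ_pi_Ioc_ae_eq_Icc (μ := fun _ => volume)).trans
      (Measure.univ_pi_Ico_ae_eq_Icc (μ := fun _ => volume)).symm
  rw [h5, Measure.restrict_smul, h6] at h4
  exact h4.comp (h2.comp h1)

theorem cellMean_eq_integral_torus {f : (Fin d → ℝ) → ℂ}
    (hf : AEStronglyMeasurable f (volume.restrict (cell d))) :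
    cellMean f = ∫ t, f (torusSection d t) := by
  obtain ⟨c, hc⟩ := measurePreserving_torusSection d
  have hprob : IsProbabilityMeasure (c • (volume : Measure (Fin d → ℝ)).restrict (cell d)) := by
    rw [← hc.map_eq]
    exact Measure.isProbabilityMeasure_map hc.measurable.aemeasurable
  have h1 := hprob.measure_univ
  rw [Measure.smul_apply, smul_eq_mul] at h1
  have h2 := hf.smul_measure c
  rw [← hc.map_eq] at h2
  rw [cellMean, average_eq', ← ENNReal.eq_inv_of_mul_eq_one_left h1, ← hc.map_eq,
    integral_map hc.measurable.aemeasurable h2]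

theorem memLp_comp_torusSection (u : L2 d) :
    MemLp (fun t => u (torusSection d t)) 2 (volume : Measure (UnitAddTorus (Fin d))) := by
  obtain ⟨c, hc⟩ := measurePreserving_torusSection d
  have hprob : IsProbabilityMeasure (c • (volume : Measure (Fin d → ℝ)).restrict (cell d)) := by
    rw [← hc.map_eq]
    exact Measure.isProbabilityMeasure_map hc.measurable.aemeasurable
  have h1 := hprob.measure_univ
  rw [Measure.smul_apply, smul_eq_mul] at h1
  have hctop : c ≠ ∞ := by
    rintro rfl
    by_cases h : (volume.restrict (cell d)) (Set.univ : Set (Fin d → ℝ)) = 0 <;>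
      simp_all
  exact ((Lp.memLp u).smul_measure hctop).comp_measurePreserving hc

/-- Parseval's identity on the cell. -/
theorem hasSum_sq_fourierCoeff (u : L2 d) :
    HasSum (fun n => ‖fourierCoeff u n‖ ^ 2)
      ((volume.real (cell d))⁻¹ * ‖u‖ ^ 2) := by
  have hm := memLp_comp_torusSection u
  have h := UnitAddTorus.hasSum_sq_mFourierCoeff (hm.toLp _)
  have hcoe := hm.coeFn_toLp
  convert h using 1
  · funext n
    congr 2
    rw [fourierCoeff, cellMean_eq_integral_torus (integrable_mul_fourierMode u n).1,
      UnitAddTorus.mFourierCoeff]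
    refine integral_congr_ae ?_
    filter_upwards [hcoe] with t ht
    rw [ht, UnitAddTorus.mFourier_neg, mFourier_eq_fourierMode, smul_eq_mul, mul_comm]
  · have h1 : ∫ t, ‖(hm.toLp _) t‖ ^ 2 = ∫ t, ‖u (torusSection d t)‖ ^ 2 := by
      refine integral_congr_ae ?_
      filter_upwards [hcoe] with t ht
      rw [ht]
    have h2 : AEStronglyMeasurable (fun y => ((‖u y‖ ^ 2 : ℝ) : ℂ)) (volume.restrict (cell d)) :=
      Complex.continuous_ofReal.comp_aestronglyMeasurable ((Lp.aestronglyMeasurable u).norm.pow 2)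
    have h3 := cellMean_eq_integral_torus h2
    rw [integral_complex_ofReal, cellMean, setAverage_eq, integral_complex_ofReal] at h3
    rw [h1]
    rw [norm_sq_L2]
    rw [Complex.real_smul] at h3
    exact_mod_cast h3

end Parseval

/-! ### The volume of the cell, constants and mean values -/

theorem volume_real_cell_pos (d : ℕ) : 0 < volume.real (cell d) := by
  have h : volume.real (cell d) = (2 * Real.pi) ^ d := by
    rw [measureReal_def, cell, Real.volume_pi_Ico_toReal (fun _ => by positivity)]
    simp
  rw [h]
  positivity

/-- The constant function `1` in `L²_♯(Y)`. -/
def oneL2 (d : ℕ) : L2 d := Lp.const 2 _ 1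

theorem coeFn_oneL2 (d : ℕ) : oneL2 d =ᵐ[volume.restrict (cell d)] fun _ => 1 :=
  Lp.coeFn_const ..

theorem inner_L2 (f g : L2 d) : inner ℂ f g = ∫ y in cell d, g y * conj (f y) := by
  rw [L2.inner_def]
  simp

theorem integrable_mul_conj (f g : L2 d) :
    Integrable (fun y => g y * conj (f y)) (volume.restrict (cell d)) := by
  simpa using L2.integrable_inner (𝕜 := ℂ) f g

theorem cellMean_eq_integral (f : (Fin d → ℝ) → ℂ) :
    cellMean f = ((volume.real (cell d))⁻¹ : ℝ) * ∫ y in cell d, f y := by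
  rw [cellMean, setAverage_eq, Complex.real_smul]

/-- The mean value as a functional on `L²_♯(Y)`. -/
def meanL2 (d : ℕ) : L2 d →L[ℂ] ℂ :=
  (((volume.real (cell d))⁻¹ : ℝ) : ℂ) • innerSL ℂ (oneL2 d)

theorem meanL2_apply (u : L2 d) :
    meanL2 d u = ((volume.real (cell d))⁻¹ : ℝ) * inner ℂ (oneL2 d) u := by
  simp [meanL2]

theorem meanL2_eq_cellMean (u : L2 d) : meanL2 d u = cellMean u := by
  rw [meanL2_apply, cellMean_eq_integral, inner_L2]
  congr 1
  refine integral_congr_ae ?_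
  filter_upwards [coeFn_oneL2 d] with y hy
  simp [hy]

theorem inner_oneL2 (u : L2 d) :
    inner ℂ (oneL2 d) u = (volume.real (cell d) : ℂ) * meanL2 d u := by
  have h : (volume.real (cell d) : ℂ) ≠ 0 := by exact_mod_cast (volume_real_cell_pos d).ne'
  rw [meanL2_apply]
  push_cast
  field_simp

theorem meanL2_one : meanL2 d (oneL2 d) = 1 := by
  have h : (volume.real (cell d) : ℂ) ≠ 0 := by exact_mod_cast (volume_real_cell_pos d).ne'
  rw [meanL2_eq_cellMean, cellMean_eq_integral, integral_congr_ae (coeFn_oneL2 d)]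
  simp only [integral_const, MeasurableSet.univ, measureReal_restrict_apply, Set.univ_inter]
  simp [h]

theorem norm_sq_oneL2 : ‖oneL2 d‖ ^ 2 = volume.real (cell d) := by
  have h := inner_oneL2 (oneL2 d)
  rw [meanL2_one, mul_one, inner_self_eq_norm_sq_to_K] at h
  exact Complex.ofReal_injective (by simpa using h)

/-! ### Fourier coefficients -/

theorem memLp_fourierMode (n : Fin d → ℤ) :
    MemLp (fourierMode n) 2 ((volume : Measure (Fin d → ℝ)).restrict (cell d)) :=
  MemLp.of_bound (continuous_fourierMode n).aestronglyMeasurable 1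
    (Filter.Eventually.of_forall fun y => (norm_fourierMode n y).le)

theorem fourierCoeff_eq_inner (u : L2 d) (n : Fin d → ℤ) :
    fourierCoeff u n =
      ((volume.real (cell d))⁻¹ : ℝ) * inner ℂ ((memLp_fourierMode n).toLp (fourierMode n)) u := by
  rw [fourierCoeff, cellMean_eq_integral, inner_L2]
  congr 1
  refine integral_congr_ae ?_
  filter_upwards [(memLp_fourierMode n).coeFn_toLp] with y hy
  rw [hy]

theorem continuous_fourierCoeff (n : Fin d → ℤ) :
    Continuous fun u : L2 d => fourierCoeff u n := by
  simp_rw [fourierCoeff_eq_inner]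
  fun_prop

theorem fourierCoeff_sum {ι : Type*} (s : Finset ι) (f : ι → L2 d) (n : Fin d → ℤ) :
    fourierCoeff (∑ i ∈ s, f i) n = ∑ i ∈ s, fourierCoeff (f i) n := by
  simp_rw [fourierCoeff_eq_inner, inner_sum, Finset.mul_sum]

theorem fourierMode_zero (y : Fin d → ℝ) : fourierMode 0 y = 1 := by
  simp [fourierMode]

theorem fourierCoeff_zero_right (u : L2 d) : fourierCoeff u 0 = meanL2 d u := by
  rw [meanL2_eq_cellMean]
  simp [fourierCoeff, fourierMode_zero]

/-- By Parseval the zero mode already exhausts the norm of the constant `1`, so no exponential has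
to be integrated. -/
theorem fourierCoeff_oneL2 {n : Fin d → ℤ} (hn : n ≠ 0) : fourierCoeff (oneL2 d) n = 0 := by
  have h := hasSum_sq_fourierCoeff (oneL2 d)
  rw [norm_sq_oneL2, inv_mul_cancel₀ (volume_real_cell_pos d).ne'] at h
  have h2 := sum_le_hasSum {0, n} (fun i _ => sq_nonneg _) h
  rw [Finset.sum_pair hn.symm, fourierCoeff_zero_right, meanL2_one] at h2
  have h3 : ‖fourierCoeff (oneL2 d) n‖ ^ 2 ≤ 0 := by simpa using h2
  simpa using le_antisymm h3 (sq_nonneg _)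

/-! ### Structure of `H²_♯(Y)` -/

/-- The defining relations equate continuous functionals. Closedness makes `H²` complete, as
adjoints, coercive inversion and the implicit function theorem require. -/
theorem isClosed_sobolevH2 (d : ℕ) :
    IsClosed (sobolevH2 d : Set (PiLp 2 fun _ : JetIndex d => L2 d)) := by
  have hp : ∀ (j : Fin d) (a b : JetIndex d),
      IsClosed {w : PiLp 2 fun _ : JetIndex d => L2 d | IsPartialDeriv j (w a) (w b)} := by
    intro j a b
    simp only [IsPartialDeriv, Set.ofPred_forall]
    refine isClosed_iInter fun n => isClosed_eq ?_ (continuous_const.mul ?_)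
    · exact (continuous_fourierCoeff n).comp (PiLp.continuous_apply 2 _ b)
    · exact (continuous_fourierCoeff n).comp (PiLp.continuous_apply 2 _ a)
  have h : (sobolevH2 d : Set (PiLp 2 fun _ : JetIndex d => L2 d)) =
      (⋂ j, {w | IsPartialDeriv j (w (.inl ())) (w (.inr (.inl j)))}) ∩
      ⋂ j, ⋂ k, {w | IsPartialDeriv k (w (.inr (.inl j))) (w (.inr (.inr (j, k))))} := by
    ext w
    simp [sobolevH2]
  rw [h]
  exact (isClosed_iInter fun j => hp _ _ _).inter
    (isClosed_iInter fun j => isClosed_iInter fun k => hp _ _ _)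

instance : CompleteSpace (H2 d) := (isClosed_sobolevH2 d).completeSpace_coe

namespace H2

/-- The embedding `H²_♯(Y) → L²_♯(Y)`. -/
def toL2L (d : ℕ) : H2 d →L[ℂ] L2 d :=
  PiLp.proj 2 (fun _ : JetIndex d => L2 d) (.inl ()) ∘L (sobolevH2 d).subtypeL

/-- `∂_j` as an operator `H²_♯(Y) → L²_♯(Y)`. -/
def gradL (j : Fin d) : H2 d →L[ℂ] L2 d :=
  PiLp.proj 2 (fun _ : JetIndex d => L2 d) (.inr (.inl j)) ∘L (sobolevH2 d).subtypeL

/-- `Δ` as an operator `H²_♯(Y) → L²_♯(Y)`. -/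
def laplacianL (d : ℕ) : H2 d →L[ℂ] L2 d :=
  ∑ j, PiLp.proj 2 (fun _ : JetIndex d => L2 d) (.inr (.inr (j, j))) ∘L (sobolevH2 d).subtypeL

theorem toL2L_apply (u : H2 d) : toL2L d u = u.toL2 := rfl

theorem laplacianL_apply (u : H2 d) : laplacianL d u = u.laplacian := by
  simp [laplacianL, laplacian, hess]

theorem shiftedGrad_eq (η : EuclideanSpace ℝ (Fin d)) (u : H2 d) (j : Fin d) :
    shiftedGrad η u j = gradL j u + (Complex.I * (η j : ℂ)) • toL2L d u := rfl

theorem shiftedLaplacian_eq (η : EuclideanSpace ℝ (Fin d)) (u : H2 d) :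
    shiftedLaplacian η u = laplacianL d u + ∑ j, (2 * Complex.I * (η j : ℂ)) • gradL j u
      - ((‖η‖ ^ 2 : ℝ) : ℂ) • toL2L d u := by
  rw [shiftedLaplacian, laplacianL_apply]
  rfl

/-- The constant function `1` in `H²_♯(Y)`. -/
def one (d : ℕ) : H2 d :=
  ⟨WithLp.toLp 2 (Sum.elim (fun _ => oneL2 d) fun _ => 0), by
    constructor
    · intro j n
      change fourierCoeff (0 : L2 d) n = _ * fourierCoeff (oneL2 d) n
      rw [fourierCoeff_zero]
      by_cases hn : n = 0
      · simp [hn]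
      · rw [fourierCoeff_oneL2 hn, mul_zero]
    · intro j k n
      change fourierCoeff (0 : L2 d) n = _ * fourierCoeff (0 : L2 d) n
      rw [fourierCoeff_zero, mul_zero]⟩

theorem toL2L_one : toL2L d (one d) = oneL2 d := rfl

theorem gradL_one (j : Fin d) : gradL j (one d) = 0 := rfl

theorem laplacianL_one : laplacianL d (one d) = 0 := by
  rw [laplacianL_apply, laplacian]
  exact Finset.sum_eq_zero fun j _ => rfl

/-- The mean value as a functional on `H²_♯(Y)`. -/
def mean (d : ℕ) : H2 d →L[ℂ] ℂ := meanL2 d ∘L toL2L d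

theorem mean_eq (u : H2 d) : mean d u = meanL2 d (toL2L d u) := rfl

theorem mean_eq_cellMean (u : H2 d) : mean d u = cellMean u.toL2 := meanL2_eq_cellMean _

theorem mean_one : mean d (one d) = 1 := meanL2_one

theorem fourierCoeff_grad (u : H2 d) (j : Fin d) (n : Fin d → ℤ) :
    fourierCoeff (u.grad j) n = Complex.I * (n j : ℂ) * fourierCoeff u.toL2 n :=
  u.2.1 j n

theorem fourierCoeff_hess (u : H2 d) (j k : Fin d) (n : Fin d → ℤ) :
    fourierCoeff (u.hess j k) n = -((n j : ℂ) * (n k : ℂ)) * fourierCoeff u.toL2 n := by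
  have h := u.2.2 j k n
  change _ = _ * fourierCoeff (u.grad j) n at h
  rw [fourierCoeff_grad] at h
  change fourierCoeff (u.hess j k) n = _ at h
  rw [h]
  linear_combination (n j : ℂ) * (n k : ℂ) * fourierCoeff u.toL2 n * Complex.I_sq

theorem fourierCoeff_laplacian (u : H2 d) (n : Fin d → ℤ) :
    fourierCoeff u.laplacian n = ((-∑ j, (n j : ℝ) ^ 2 : ℝ) : ℂ) * fourierCoeff u.toL2 n := by
  rw [laplacian, fourierCoeff_sum]
  simp_rw [fourierCoeff_hess]
  push_cast
  rw [← Finset.sum_neg_distrib, Finset.sum_mul]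
  refine Finset.sum_congr rfl fun j _ => by ring

theorem fourierCoeff_shiftedGrad (η : EuclideanSpace ℝ (Fin d)) (u : H2 d) (j : Fin d)
    (n : Fin d → ℤ) :
    fourierCoeff (shiftedGrad η u j) n =
      Complex.I * ((n j + η j : ℝ) : ℂ) * fourierCoeff u.toL2 n := by
  rw [shiftedGrad, fourierCoeff_add, fourierCoeff_smul, fourierCoeff_grad]
  push_cast
  ring

/-! ### Norm estimates on `H²_♯(Y)` from Fourier coefficients -/

theorem norm_sq_eq (u : H2 d) :
    ‖u‖ ^ 2 = ‖u.toL2‖ ^ 2 + (∑ j, ‖u.grad j‖ ^ 2 + ∑ j, ∑ k, ‖u.hess j k‖ ^ 2) := by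
  have h := PiLp.norm_sq_eq_of_L2 (fun _ : JetIndex d => L2 d) u.1
  rw [Fintype.sum_sum_type, Fintype.sum_sum_type, Fintype.sum_prod_type] at h
  simp only [Finset.univ_unique, Finset.sum_singleton] at h
  exact h

/-- The shifted Poincaré–Wirtinger inequality. -/
theorem norm_sq_toL2_le (η : EuclideanSpace ℝ (Fin d)) (hη : ∀ j, |η j| ≤ 1 / 2) (u : H2 d) :
    ‖u.toL2‖ ^ 2 ≤ volume.real (cell d) * ‖mean d u‖ ^ 2 + 4 * ∑ j, ‖shiftedGrad η u j‖ ^ 2 := by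
  have hV := volume_real_cell_pos d
  have h1 := hasSum_sq_fourierCoeff u.toL2
  have h2 := hasSum_sum fun j (_ : j ∈ Finset.univ) => hasSum_sq_fourierCoeff (shiftedGrad η u j)
  have h3 := (hasSum_ite_eq (0 : Fin d → ℤ) (‖mean d u‖ ^ 2)).add (h2.mul_left 4)
  have h4 := hasSum_le (fun n => ?_) h1 h3
  · rw [← Finset.mul_sum] at h4
    have h5 := mul_le_mul_of_nonneg_left h4 hV.le
    calc ‖u.toL2‖ ^ 2 = volume.real (cell d) * ((volume.real (cell d))⁻¹ * ‖u.toL2‖ ^ 2) := by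
          field_simp
      _ ≤ _ := h5
      _ = _ := by field_simp
  · split_ifs with hn
    · have : ‖fourierCoeff u.toL2 n‖ ^ 2 = ‖mean d u‖ ^ 2 := by
        rw [hn, fourierCoeff_zero_right]; rfl
      rw [this]
      have : 0 ≤ ∑ i, ‖fourierCoeff (shiftedGrad η u i) n‖ ^ 2 :=
        Finset.sum_nonneg fun _ _ => sq_nonneg _
      linarith
    -- A nonzero mode has some `|n_j| ≥ 1`; with `|η_j| ≤ 1/2` this gives `(n_j + η_j)² ≥ 1/4`, the
    -- source of the factor 4.
    · obtain ⟨j, hj⟩ : ∃ j, n j ≠ 0 := by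
        by_contra! h
        exact hn (funext h)
      have h6 : ‖fourierCoeff (shiftedGrad η u j) n‖ ^ 2 ≤
          ∑ i, ‖fourierCoeff (shiftedGrad η u i) n‖ ^ 2 :=
        Finset.single_le_sum (f := fun i => ‖fourierCoeff (shiftedGrad η u i) n‖ ^ 2)
          (fun _ _ => sq_nonneg _) (Finset.mem_univ j)
      rw [fourierCoeff_shiftedGrad, norm_mul, norm_mul, Complex.norm_I, one_mul, mul_pow,
        Complex.norm_real, Real.norm_eq_abs, sq_abs] at h6
      have h7 : (1 : ℝ) ≤ |(n j : ℝ)| := by exact_mod_cast Int.one_le_abs hj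
      have h8 : 1 / 2 ≤ |(n j : ℝ) + η j| := by
        have := abs_sub_abs_le_abs_sub (n j : ℝ) (-η j)
        rw [abs_neg, sub_neg_eq_add] at this
        linarith [hη j]
      have h9 : 1 / 4 ≤ ((n j : ℝ) + η j) ^ 2 := by
        rw [← sq_abs]; nlinarith
      nlinarith [sq_nonneg ‖fourierCoeff u.toL2 n‖]

/-- On the Fourier side this is `∑ n_j² n_k² = (∑ n_j²)²`; it lets the Laplacian alone control all
second derivatives. -/
theorem sum_norm_sq_hess (u : H2 d) : ∑ j, ∑ k, ‖u.hess j k‖ ^ 2 = ‖u.laplacian‖ ^ 2 := by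
  have hV := volume_real_cell_pos d
  have h1 := hasSum_sq_fourierCoeff u.laplacian
  have h2 := hasSum_sum fun j (_ : j ∈ Finset.univ) =>
    hasSum_sum fun k (_ : k ∈ Finset.univ) => hasSum_sq_fourierCoeff (u.hess j k)
  simp_rw [← Finset.mul_sum] at h2
  have h3 := HasSum.unique (h2.congr_fun fun n => ?_) h1
  · exact mul_left_cancel₀ (inv_ne_zero hV.ne') h3
  · simp_rw [fourierCoeff_laplacian, fourierCoeff_hess, norm_mul, norm_neg, norm_mul, mul_pow,
      Complex.norm_real, Real.norm_eq_abs, sq_abs, Complex.norm_intCast, sq_abs, ← Finset.sum_mul]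
    rw [neg_sq, sq (∑ j, (n j : ℝ) ^ 2), Finset.sum_mul_sum]

/-- The factor 5 is 4 from the Poincaré inequality at `η = 0` plus 1 for the gradient part of the
norm. -/
theorem norm_sq_le (u : H2 d) :
    ‖u‖ ^ 2 ≤ volume.real (cell d) * ‖mean d u‖ ^ 2 + 5 * ∑ j, ‖u.grad j‖ ^ 2 +
      ‖u.laplacian‖ ^ 2 := by
  have h := norm_sq_toL2_le 0 (by simp) u
  simp only [shiftedGrad, PiLp.zero_apply, Complex.ofReal_zero, mul_zero, zero_smul, add_zero] at h
  rw [norm_sq_eq, sum_norm_sq_hess]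
  linarith

end H2

/-! ### Multiplication by the coefficients -/

theorem IsCoefficient.memLp_entry (hA : IsCoefficient A) (j k : Fin d) :
    MemLp (fun y => (A y j k : ℂ)) ∞ (volume.restrict (cell d)) := by
  obtain ⟨C, hC⟩ := hA.bounded
  refine MemLp.of_bound (C := C) ?_ ?_
  · exact (Complex.measurable_ofReal.comp_aemeasurable
      (hA.measurable j k).restrict).aestronglyMeasurable
  · filter_upwards [ae_restrict_of_ae (hC j k)] with y hy
    simpa using hy

/-- Multiplication by `a_{jk}` on `L²_♯(Y)`. -/
def coeffMul (hA : IsCoefficient A) (j k : Fin d) : L2 d →L[ℂ] L2 d :=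
  (ContinuousLinearMap.mul ℂ ℂ).holderL (volume.restrict (cell d)) ∞ 2 2
    ((hA.memLp_entry j k).toLp _)

theorem coeFn_coeffMul (hA : IsCoefficient A) (j k : Fin d) (f : L2 d) :
    coeffMul hA j k f =ᵐ[volume.restrict (cell d)] fun y => (A y j k : ℂ) * f y := by
  have h := (ContinuousLinearMap.mul ℂ ℂ).coeFn_holder (r := 2) ((hA.memLp_entry j k).toLp _) f
  filter_upwards [h, (hA.memLp_entry j k).coeFn_toLp] with y hy h2
  rw [coeffMul, ContinuousLinearMap.holderL_apply_apply, hy, h2]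
  rfl

theorem inner_coeffMul (hA : IsCoefficient A) (j k : Fin d) (p q : L2 d) :
    inner ℂ p (coeffMul hA j k q) = ∫ y in cell d, (A y j k : ℂ) * q y * conj (p y) := by
  rw [inner_L2]
  refine integral_congr_ae ?_
  filter_upwards [coeFn_coeffMul hA j k q] with y hy
  rw [hy]

theorem integrable_coeff (hA : IsCoefficient A) (j k : Fin d) (p q : L2 d) :
    Integrable (fun y => (A y j k : ℂ) * q y * conj (p y)) (volume.restrict (cell d)) := by
  refine (integrable_mul_conj p (coeffMul hA j k q)).congr ?_
  filter_upwards [coeFn_coeffMul hA j k q] with y hy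
  rw [hy]

theorem inner_coeffMul_conj (hA : IsCoefficient A) (j k : Fin d) (p q : L2 d) :
    conj (inner ℂ p (coeffMul hA j k q)) = inner ℂ q (coeffMul hA k j p) := by
  rw [inner_coeffMul, inner_coeffMul, ← integral_conj]
  refine integral_congr_ae ?_
  filter_upwards [ae_restrict_of_ae hA.symmetric] with y hy
  simp only [map_mul, Complex.conj_conj, Complex.conj_ofReal]
  rw [hy.apply]
  ring

/-- The sesquilinear form `∫_Y A q · conj p`. -/
def coeffForm (hA : IsCoefficient A) (p q : Fin d → L2 d) : ℂ :=
  ∑ j, ∑ k, inner ℂ (p j) (coeffMul hA j k (q k))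

theorem coeffForm_eq_integral (hA : IsCoefficient A) (p q : Fin d → L2 d) :
    coeffForm hA p q = ∫ y in cell d, ∑ j, ∑ k, (A y j k : ℂ) * q k y * conj (p j y) := by
  rw [integral_finsetSum _ fun j _ => integrable_finsetSum _ fun k _ => integrable_coeff hA j k _ _]
  simp_rw [integral_finsetSum _ fun k _ => integrable_coeff hA _ k _ _, coeffForm, inner_coeffMul]

theorem coeffForm_conj (hA : IsCoefficient A) (p q : Fin d → L2 d) :
    conj (coeffForm hA p q) = coeffForm hA q p := by
  simp_rw [coeffForm, map_sum, inner_coeffMul_conj]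
  exact Finset.sum_comm

/-- Ellipticity is applied to real and imaginary parts separately; the cross terms are purely
imaginary for each pair of indices. -/
theorem re_coeff_quadratic_ge {M : Matrix (Fin d) (Fin d) ℝ} {α : ℝ}
    (h : ∀ ξ : Fin d → ℝ, α * ∑ j, ξ j ^ 2 ≤ ∑ j, ∑ k, M j k * ξ k * ξ j) (p : Fin d → ℂ) :
    α * ∑ j, ‖p j‖ ^ 2 ≤ (∑ j, ∑ k, (M j k : ℂ) * p k * conj (p j)).re := by
  have h1 := h fun j => (p j).re
  have h2 := h fun j => (p j).im
  have e1 : ∑ j, ‖p j‖ ^ 2 = ∑ j, (p j).re ^ 2 + ∑ j, (p j).im ^ 2 := by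
    rw [← Finset.sum_add_distrib]
    refine Finset.sum_congr rfl fun j _ => ?_
    rw [← Complex.normSq_eq_norm_sq, Complex.normSq_apply]
    ring
  have e2 : (∑ j, ∑ k, (M j k : ℂ) * p k * conj (p j)).re =
      ∑ j, ∑ k, M j k * (p k).re * (p j).re + ∑ j, ∑ k, M j k * (p k).im * (p j).im := by
    simp_rw [Complex.re_sum, ← Finset.sum_add_distrib]
    refine Finset.sum_congr rfl fun j _ => Finset.sum_congr rfl fun k _ => ?_
    simp
  rw [e1, e2]
  linarith

theorem re_coeffForm_ge (hA : IsCoefficient A) {α : ℝ}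
    (h : ∀ᵐ y, ∀ ξ : Fin d → ℝ, α * ∑ j, ξ j ^ 2 ≤ ∑ j, ∑ k, A y j k * ξ k * ξ j)
    (p : Fin d → L2 d) : α * ∑ j, ‖p j‖ ^ 2 ≤ (coeffForm hA p p).re := by
  have hint : ∀ j : Fin d, Integrable (fun y => ‖p j y‖ ^ 2) (volume.restrict (cell d)) :=
    fun j => (Lp.memLp (p j)).integrable_norm_pow (by norm_num)
  have hint2 : Integrable (fun y => ∑ j, ∑ k, (A y j k : ℂ) * p k y * conj (p j y))
      (volume.restrict (cell d)) :=
    integrable_finsetSum _ fun j _ => integrable_finsetSum _ fun k _ => integrable_coeff hA j k _ _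
  have h2 : (coeffForm hA p p).re =
      ∫ y in cell d, (∑ j, ∑ k, (A y j k : ℂ) * p k y * conj (p j y)).re := by
    rw [coeffForm_eq_integral]
    exact (integral_re hint2).symm
  simp_rw [norm_sq_L2]
  rw [h2, ← integral_finsetSum _ fun j _ => hint j, ← integral_const_mul]
  refine integral_mono_ae ((integrable_finsetSum _ fun j _ => hint j).const_mul α) hint2.re ?_
  filter_upwards [ae_restrict_of_ae h] with y hy
  exact re_coeff_quadratic_ge hy fun j => p j y

/-! ### Weak formulations in terms of inner products -/

theorem blochForm_eq (hA : IsCoefficient A) (η : EuclideanSpace ℝ (Fin d)) (u v : H2 d) :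
    blochForm A ρ η u v = coeffForm hA (H2.shiftedGrad η v) (H2.shiftedGrad η u) +
      (ρ : ℂ) ^ 2 * inner ℂ (H2.shiftedLaplacian η v) (H2.shiftedLaplacian η u) := by
  rw [blochForm, coeffForm_eq_integral, inner_L2]

theorem solvesBloch_iff {η : EuclideanSpace ℝ (Fin d)} {μ : ℝ} {u : H2 d} :
    SolvesBloch A ρ η μ u ↔
      ∀ v : H2 d, blochForm A ρ η u v = μ * inner ℂ (H2.toL2L d v) (H2.toL2L d u) := by
  simp_rw [inner_L2]
  rfl

theorem blochForm_conj (hA : IsCoefficient A) (η : EuclideanSpace ℝ (Fin d)) (u v : H2 d) :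
    conj (blochForm A ρ η u v) = blochForm A ρ η v u := by
  rw [blochForm_eq hA, blochForm_eq hA, map_add, map_mul, coeffForm_conj, inner_conj_symm]
  simp

/-- The energy dominates the shifted gradient and the shifted Laplacian. -/
theorem re_blochForm_ge (hA : IsCoefficient A) {α : ℝ}
    (h : ∀ᵐ y, ∀ ξ : Fin d → ℝ, α * ∑ j, ξ j ^ 2 ≤ ∑ j, ∑ k, A y j k * ξ k * ξ j)
    (η : EuclideanSpace ℝ (Fin d)) (u : H2 d) :
    α * ∑ j, ‖H2.shiftedGrad η u j‖ ^ 2 + ρ ^ 2 * ‖H2.shiftedLaplacian η u‖ ^ 2 ≤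
      (blochForm A ρ η u u).re := by
  rw [blochForm_eq hA, inner_self_eq_norm_sq_to_K, Complex.add_re]
  have h1 := re_coeffForm_ge hA h (H2.shiftedGrad η u)
  have h2 : (((ρ : ℂ) ^ 2 * (‖H2.shiftedLaplacian η u‖ : ℂ) ^ 2)).re =
      ρ ^ 2 * ‖H2.shiftedLaplacian η u‖ ^ 2 := by
    rw [← Complex.ofReal_pow, ← Complex.ofReal_pow, ← Complex.ofReal_mul, Complex.ofReal_re]
  exact add_le_add h1 h2.ge

theorem solvesCellProblem_iff (hA : IsCoefficient A) {l : Fin d} {χ : H2 d} :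
    SolvesCellProblem A ρ l χ ↔ H2.mean d χ = 0 ∧ ∀ v : H2 d,
      (ρ : ℂ) ^ 2 * inner ℂ (H2.laplacianL d v) (H2.laplacianL d χ) +
        coeffForm hA (fun j => H2.gradL j v)
          (fun k => (if k = l then oneL2 d else 0) + H2.gradL k χ) = 0 := by
  rw [SolvesCellProblem, H2.mean_eq_cellMean]
  refine and_congr_right fun _ => forall_congr' fun v => ?_
  rw [coeffForm_eq_integral, inner_L2, H2.laplacianL_apply, H2.laplacianL_apply]
  have hae : ∀ k : Fin d, ((if k = l then oneL2 d else 0) + H2.gradL k χ : L2 d)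
      =ᵐ[volume.restrict (cell d)] fun y => (if k = l then 1 else 0) + χ.grad k y := by
    intro k
    filter_upwards [Lp.coeFn_add (if k = l then oneL2 d else 0) (H2.gradL k χ), coeFn_oneL2 d,
      Lp.coeFn_zero ℂ 2 (volume.restrict (cell d))] with y h1 h2 h3
    rw [h1, Pi.add_apply]
    split_ifs
    · rw [h2]; rfl
    · rw [h3]; rfl
  have h : ∫ y in cell d, ∑ j, ∑ k, (A y j k : ℂ) * ((if k = l then 1 else 0) + χ.grad k y) *
      conj (v.grad j y) = ∫ y in cell d, ∑ j, ∑ k, (A y j k : ℂ) *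
        ((if k = l then oneL2 d else 0) + H2.gradL k χ : L2 d) y * conj (H2.gradL j v y) := by
    refine integral_congr_ae ?_
    filter_upwards [ae_all_iff.2 hae] with y hy
    refine Finset.sum_congr rfl fun j _ => Finset.sum_congr rfl fun k _ => ?_
    rw [hy k]
    rfl
  rw [h]

theorem homogenizedMatrix_eq (hA : IsCoefficient A) (χ : Fin d → H2 d) (k l : Fin d) :
    homogenizedMatrix A χ k l = meanL2 d (coeffMul hA k l (oneL2 d)) +
      ∑ j, meanL2 d (coeffMul hA k j (H2.gradL j (χ l))) := by
  rw [homogenizedMatrix, ← map_sum, ← map_add, meanL2_eq_cellMean, cellMean_eq_integral,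
    cellMean_eq_integral]
  congr 1
  refine integral_congr_ae ?_
  have h1 := ae_all_iff.2 fun j => coeFn_coeffMul hA k j (H2.gradL j (χ l))
  filter_upwards [h1, coeFn_oneL2 d, coeFn_coeffMul hA k l (oneL2 d),
    Lp.coeFn_add (coeffMul hA k l (oneL2 d)) (∑ j, coeffMul hA k j (H2.gradL j (χ l))),
    Lp.coeFn_finsetSum Finset.univ fun j => coeffMul hA k j (H2.gradL j (χ l))]
    with y h1 h2 h3 h4 h5
  rw [h4, Pi.add_apply, h5, Finset.sum_apply, h3, h2, mul_one]
  simp_rw [h1]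
  rfl

/-! ### Complex conjugation -/

theorem coeFn_star (f : L2 d) :
    (star f : L2 d) =ᵐ[volume.restrict (cell d)] fun y => conj (f y) :=
  Lp.coeFn_star f

instance : StarAddMonoid (L2 d) where
  star_add f g := by
    refine Lp.ext ?_
    filter_upwards [coeFn_star f, coeFn_star g, coeFn_star (f + g), Lp.coeFn_add f g,
      Lp.coeFn_add (star f) (star g)] with y h1 h2 h3 h4 h5
    rw [h3, h4, h5, Pi.add_apply, Pi.add_apply, h1, h2, map_add]

theorem inner_star_star (f g : L2 d) : inner ℂ (star f) (star g) = conj (inner ℂ f g) := by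
  rw [inner_L2, inner_L2, ← integral_conj]
  refine integral_congr_ae ?_
  filter_upwards [coeFn_star f, coeFn_star g] with y h1 h2
  rw [h1, h2, map_mul]

theorem star_oneL2 : star (oneL2 d) = oneL2 d := by
  refine Lp.ext ?_
  filter_upwards [coeFn_star (oneL2 d), coeFn_oneL2 d] with y h1 h2
  rw [h1, h2, map_one]

theorem coeffMul_star (hA : IsCoefficient A) (j k : Fin d) (f : L2 d) :
    coeffMul hA j k (star f) = star (coeffMul hA j k f) := by
  refine Lp.ext ?_
  filter_upwards [coeFn_star f, coeFn_star (coeffMul hA j k f), coeFn_coeffMul hA j k f,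
    coeFn_coeffMul hA j k (star f)] with y h1 h2 h3 h4
  rw [h4, h1, h2, h3, map_mul, Complex.conj_ofReal]

theorem meanL2_star (f : L2 d) : meanL2 d (star f) = conj (meanL2 d f) := by
  rw [meanL2_apply, meanL2_apply, map_mul, Complex.conj_ofReal, ← inner_star_star, star_oneL2]

theorem fourierMode_neg (n : Fin d → ℤ) (y : Fin d → ℝ) :
    fourierMode (-n) y = conj (fourierMode n y) := by
  rw [fourierMode, fourierMode, ← Complex.exp_conj]
  congr 1
  simp

theorem fourierCoeff_star (f : L2 d) (n : Fin d → ℤ) :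
    fourierCoeff (star f) n = conj (fourierCoeff f (-n)) := by
  rw [fourierCoeff, fourierCoeff, cellMean_eq_integral, cellMean_eq_integral, map_mul,
    Complex.conj_ofReal, ← integral_conj]
  congr 1
  refine integral_congr_ae ?_
  filter_upwards [coeFn_star f] with y hy
  rw [hy, fourierMode_neg, map_mul, Complex.conj_conj]

theorem IsPartialDeriv.star {j : Fin d} {u g : L2 d} (h : IsPartialDeriv j u g) :
    IsPartialDeriv j (star u) (star g) := by
  intro n
  rw [fourierCoeff_star, fourierCoeff_star, h (-n)]
  simp

theorem coeffForm_star (hA : IsCoefficient A) (p q : Fin d → L2 d) :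
    coeffForm hA (fun j => star (p j)) (fun j => star (q j)) = conj (coeffForm hA p q) := by
  simp_rw [coeffForm, map_sum, coeffMul_star, inner_star_star]

namespace H2

/-- Complex conjugation on `H²_♯(Y)`. -/
def conjugate (u : H2 d) : H2 d :=
  ⟨WithLp.toLp 2 fun i => star (u.1 i), fun j => (u.2.1 j).star, fun j k => (u.2.2 j k).star⟩

theorem toL2L_conjugate (u : H2 d) : toL2L d u.conjugate = star (toL2L d u) := rfl

theorem gradL_conjugate (j : Fin d) (u : H2 d) : gradL j u.conjugate = star (gradL j u) := rfl

theorem laplacianL_conjugate (u : H2 d) : laplacianL d u.conjugate = star (laplacianL d u) := by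
  rw [laplacianL_apply, laplacianL_apply, laplacian, laplacian, star_sum]
  rfl

end H2

/-- As `A` is real, conjugating the weak equation tested against the conjugate of `v` gives the
equation for the conjugate of `χ`. Uniqueness will then make the correctors real. -/
theorem SolvesCellProblem.conjugate (hA : IsCoefficient A) {l : Fin d} {χ : H2 d}
    (h : SolvesCellProblem A ρ l χ) : SolvesCellProblem A ρ l χ.conjugate := by
  rw [solvesCellProblem_iff hA] at h ⊢
  refine ⟨?_, fun v => ?_⟩
  · rw [H2.mean_eq, H2.toL2L_conjugate, meanL2_star, ← H2.mean_eq, h.1, map_zero]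
  · have h2 := congrArg conj (h.2 v.conjugate)
    rw [map_add, map_mul, ← inner_star_star, ← coeffForm_star, H2.laplacianL_conjugate,
      star_star] at h2
    simp only [H2.gradL_conjugate, star_star, star_add, map_zero, map_pow,
      Complex.conj_ofReal, apply_ite star, star_oneL2, star_zero] at h2
    simpa only [H2.laplacianL_conjugate, H2.gradL_conjugate] using h2

open scoped ContDiff Topology

instance : Inner ℂ (H2 d) := InnerProductSpace.toInner

theorem H2.inner_smul_right (c : ℂ) (u v : H2 d) : inner ℂ v (c • u) = c * inner ℂ v u :=
  _root_.inner_smul_right v u c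

/-! ### The shifted operator -/

section ShiftedOperator

open ContinuousLinearMap in
/-- The adjoint of `(∂_j + i η_j) : H²_♯(Y) → L²_♯(Y)`. -/
def shiftedGradAdj (η : EuclideanSpace ℝ (Fin d)) (j : Fin d) (p : L2 d) : H2 d :=
  adjoint (H2.gradL j) p - (Complex.I * (η j : ℂ)) • adjoint (H2.toL2L d) p

open ContinuousLinearMap in
/-- The adjoint of `(∇ + i η)² : H²_♯(Y) → L²_♯(Y)`. -/
def shiftedLaplacianAdj (η : EuclideanSpace ℝ (Fin d)) (p : L2 d) : H2 d :=
  adjoint (H2.laplacianL d) p - ∑ j, (2 * Complex.I * (η j : ℂ)) • adjoint (H2.gradL j) p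
    - ((‖η‖ ^ 2 : ℝ) : ℂ) • adjoint (H2.toL2L d) p

theorem inner_shiftedGradAdj (η : EuclideanSpace ℝ (Fin d)) (j : Fin d) (v : H2 d) (p : L2 d) :
    inner ℂ v (shiftedGradAdj η j p) = inner ℂ (H2.shiftedGrad η v j) p := by
  rw [shiftedGradAdj, H2.shiftedGrad_eq, inner_sub_right, inner_add_left, inner_smul_left,
    H2.inner_smul_right, ContinuousLinearMap.adjoint_inner_right,
    ContinuousLinearMap.adjoint_inner_right]
  simp [sub_eq_add_neg]

theorem inner_shiftedLaplacianAdj (η : EuclideanSpace ℝ (Fin d)) (v : H2 d) (p : L2 d) :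
    inner ℂ v (shiftedLaplacianAdj η p) = inner ℂ (H2.shiftedLaplacian η v) p := by
  rw [shiftedLaplacianAdj, H2.shiftedLaplacian_eq, inner_sub_right, inner_sub_right,
    inner_sub_left, inner_add_left, inner_sum, sum_inner]
  simp_rw [inner_smul_left, H2.inner_smul_right, ContinuousLinearMap.adjoint_inner_right]
  simp [sub_eq_add_neg, Complex.conj_ofNat]

/-- The operator on `H²_♯(Y)` representing the form `a^ρ[η]`. -/
def blochOp (hA : IsCoefficient A) (ρ : ℝ) (η : EuclideanSpace ℝ (Fin d)) (u : H2 d) : H2 d :=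
  ∑ j, ∑ k, shiftedGradAdj η j (coeffMul hA j k (H2.shiftedGrad η u k)) +
    ((ρ : ℂ) ^ 2) • shiftedLaplacianAdj η (H2.shiftedLaplacian η u)

theorem inner_blochOp (hA : IsCoefficient A) (η : EuclideanSpace ℝ (Fin d)) (u v : H2 d) :
    inner ℂ v (blochOp hA ρ η u) = blochForm A ρ η u v := by
  rw [blochOp, blochForm_eq hA, inner_add_right, H2.inner_smul_right, inner_shiftedLaplacianAdj,
    coeffForm]
  simp_rw [inner_sum, inner_shiftedGradAdj]

/-- The operators are complex linear, while smoothness is over `ℝ` because `η` is real. -/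
theorem contDiff_clm {E F : Type*} [NormedAddCommGroup E] [NormedSpace ℂ E] [NormedSpace ℝ E]
    [IsScalarTower ℝ ℂ E]
    [NormedAddCommGroup F] [NormedSpace ℂ F] [NormedSpace ℝ F] [IsScalarTower ℝ ℂ F]
    {G : Type*} [NormedAddCommGroup G] [NormedSpace ℝ G] (T : E →L[ℂ] F) {f : G → E}
    {n : WithTop ℕ∞} (hf : ContDiff ℝ n f) : ContDiff ℝ n fun x => T (f x) :=
  (T.restrictScalars ℝ).contDiff.comp hf

variable {G : Type*} [NormedAddCommGroup G] [NormedSpace ℝ G] {n : WithTop ℕ∞}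
  {f : G → EuclideanSpace ℝ (Fin d)}

theorem contDiff_coord (hf : ContDiff ℝ n f) (j : Fin d) : ContDiff ℝ n fun x => (f x j : ℂ) :=
  Complex.ofRealCLM.contDiff.comp ((EuclideanSpace.proj (𝕜 := ℝ) j).contDiff.comp hf)

theorem contDiff_shiftedGrad (hf : ContDiff ℝ n f) {u : G → H2 d} (hu : ContDiff ℝ n u)
    (j : Fin d) : ContDiff ℝ n fun x => H2.shiftedGrad (f x) (u x) j := by
  simp_rw [H2.shiftedGrad_eq]
  exact (contDiff_clm _ hu).add
    ((contDiff_const.mul (contDiff_coord hf j)).fun_smul (contDiff_clm _ hu))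

theorem contDiff_norm_sq_coe (hf : ContDiff ℝ n f) :
    ContDiff ℝ n fun x => ((‖f x‖ ^ 2 : ℝ) : ℂ) :=
  Complex.ofRealCLM.contDiff.comp (hf.norm_sq ℝ)

theorem contDiff_shiftedLaplacian (hf : ContDiff ℝ n f) {u : G → H2 d} (hu : ContDiff ℝ n u) :
    ContDiff ℝ n fun x => H2.shiftedLaplacian (f x) (u x) := by
  simp_rw [H2.shiftedLaplacian_eq]
  refine ((contDiff_clm _ hu).add (ContDiff.sum fun j _ => ?_)).sub
    ((contDiff_norm_sq_coe hf).fun_smul (contDiff_clm _ hu))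
  exact (contDiff_const.mul (contDiff_coord hf j)).fun_smul (contDiff_clm _ hu)

/-- Polynomial in `η` and linear in `u`. The order `n` is arbitrary so that `n = ω` yields
analyticity. -/
theorem contDiff_blochOp (hA : IsCoefficient A) (hf : ContDiff ℝ n f) {u : G → H2 d}
    (hu : ContDiff ℝ n u) : ContDiff ℝ n fun x => blochOp hA ρ (f x) (u x) := by
  unfold blochOp shiftedGradAdj shiftedLaplacianAdj
  have hL := contDiff_shiftedLaplacian hf hu
  refine (ContDiff.sum fun j _ => ContDiff.sum fun k _ => ?_).add (contDiff_const.fun_smul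
    (((contDiff_clm _ hL).sub (ContDiff.sum fun j _ => ?_)).sub
    ((contDiff_norm_sq_coe hf).fun_smul (contDiff_clm _ hL))))
  · have h := contDiff_clm (coeffMul hA j k) (contDiff_shiftedGrad hf hu k)
    exact (contDiff_clm _ h).sub
      ((contDiff_const.mul (contDiff_coord hf j)).fun_smul (contDiff_clm _ h))
  · exact (contDiff_const.mul (contDiff_coord hf j)).fun_smul (contDiff_clm _ hL)

end ShiftedOperator

/-! ### The operator at `η = 0` -/

theorem shiftedGrad_zero (u : H2 d) (j : Fin d) : H2.shiftedGrad 0 u j = H2.gradL j u := by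
  simp [H2.shiftedGrad_eq]

theorem shiftedLaplacian_zero (u : H2 d) : H2.shiftedLaplacian 0 u = H2.laplacianL d u := by
  simp [H2.shiftedLaplacian_eq]

open ContinuousLinearMap in
/-- The operator representing `a^ρ[0]`. -/
def cellOp (hA : IsCoefficient A) (ρ : ℝ) : H2 d →L[ℂ] H2 d :=
  ∑ j, ∑ k, adjoint (H2.gradL j) ∘L coeffMul hA j k ∘L H2.gradL k +
    ((ρ : ℂ) ^ 2) • (adjoint (H2.laplacianL d) ∘L H2.laplacianL d)

theorem blochOp_zero (hA : IsCoefficient A) (u : H2 d) : blochOp hA ρ 0 u = cellOp hA ρ u := by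
  simp [blochOp, cellOp, shiftedGradAdj, shiftedLaplacianAdj, shiftedGrad_zero,
    shiftedLaplacian_zero]

theorem inner_cellOp (hA : IsCoefficient A) (u v : H2 d) :
    inner ℂ v (cellOp hA ρ u) = coeffForm hA (fun j => H2.gradL j v) (fun j => H2.gradL j u) +
      (ρ : ℂ) ^ 2 * inner ℂ (H2.laplacianL d v) (H2.laplacianL d u) := by
  rw [← blochOp_zero, inner_blochOp, blochForm_eq hA]
  simp_rw [shiftedLaplacian_zero]
  congr 2 <;> funext j <;> exact shiftedGrad_zero _ j

theorem cellOp_one (hA : IsCoefficient A) : cellOp hA ρ (H2.one d) = 0 := by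
  simp [cellOp, H2.gradL_one, H2.laplacianL_one]

open ContinuousLinearMap in
/-- The operator `a^ρ[0]` corrected on constants. -/
def correctedOp (hA : IsCoefficient A) (ρ c : ℝ) : H2 d →L[ℂ] H2 d :=
  cellOp hA ρ + (H2.mean d).smulRight ((c : ℂ) • adjoint (H2.toL2L d) (oneL2 d))

theorem inner_adjoint_oneL2 (v : H2 d) :
    inner ℂ v (ContinuousLinearMap.adjoint (H2.toL2L d) (oneL2 d)) =
      (volume.real (cell d) : ℂ) * conj (H2.mean d v) := by
  rw [ContinuousLinearMap.adjoint_inner_right, ← inner_conj_symm, inner_oneL2, map_mul,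
    Complex.conj_ofReal]
  rfl

theorem inner_correctedOp (hA : IsCoefficient A) (c : ℝ) (u v : H2 d) :
    inner ℂ v (correctedOp hA ρ c u) = inner ℂ v (cellOp hA ρ u) +
      c * volume.real (cell d) * (H2.mean d u * conj (H2.mean d v)) := by
  rw [correctedOp, add_apply, inner_add_right,
    ContinuousLinearMap.smulRight_apply, H2.inner_smul_right, H2.inner_smul_right,
    inner_adjoint_oneL2]
  ring

/-- Ellipticity controls the gradient, `ρ²` the Laplacian, and the rank-one term the mean;
`H2.norm_sq_le` says that these control the whole norm. -/
theorem correctedOp_coercive (hA : IsCoefficient A) (hρ : 0 < ρ) {c : ℝ} (hc : 0 < c) :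
    ∃ κ : ℝ, 0 < κ ∧ ∀ u : H2 d, κ * ‖u‖ ^ 2 ≤ (inner ℂ u (correctedOp hA ρ c u)).re := by
  obtain ⟨α, hα, h⟩ := hA.elliptic
  -- The three entries match the weights on mean, gradient and Laplacian in `H2.norm_sq_le`.
  refine ⟨min c (min (α / 5) (ρ ^ 2)), by positivity, fun u => ?_⟩
  have h1 := re_blochForm_ge (ρ := ρ) hA h 0 u
  rw [← inner_blochOp hA, blochOp_zero] at h1
  simp_rw [shiftedGrad_zero, shiftedLaplacian_zero] at h1
  have h2 : (inner ℂ u (correctedOp hA ρ c u)).re = (inner ℂ u (cellOp hA ρ u)).re +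
      c * volume.real (cell d) * ‖H2.mean d u‖ ^ 2 := by
    rw [inner_correctedOp, Complex.mul_conj, Complex.normSq_eq_norm_sq, Complex.add_re]
    congr 1
    rw [← Complex.ofReal_mul, ← Complex.ofReal_mul, Complex.ofReal_re]
  have h3 := H2.norm_sq_le u
  rw [h2]
  set κ := min c (min (α / 5) (ρ ^ 2)) with hκ
  have k0 : 0 < κ := by positivity
  have k1 : κ ≤ c := min_le_left _ _
  have k2 : κ ≤ α / 5 := (min_le_right _ _).trans (min_le_left _ _)
  have k3 : κ ≤ ρ ^ 2 := (min_le_right _ _).trans (min_le_right _ _)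
  have hG : 0 ≤ ∑ j, ‖u.grad j‖ ^ 2 := Finset.sum_nonneg fun _ _ => sq_nonneg _
  have hm : 0 ≤ volume.real (cell d) * ‖H2.mean d u‖ ^ 2 := by positivity
  have hL : 0 ≤ ‖u.laplacian‖ ^ 2 := sq_nonneg _
  have h4 : α * ∑ j, ‖u.grad j‖ ^ 2 + ρ ^ 2 * ‖u.laplacian‖ ^ 2 ≤
      (inner ℂ u (cellOp hA ρ u)).re := by
    rw [H2.laplacianL_apply] at h1
    exact h1
  have p1 := mul_le_mul_of_nonneg_left h3 k0.le
  have p2 := mul_le_mul_of_nonneg_right k1 hm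
  have p3 := mul_le_mul_of_nonneg_right k2 hG
  have p4 := mul_le_mul_of_nonneg_right k3 hL
  linarith

theorem isUnit_correctedOp (hA : IsCoefficient A) (hρ : 0 < ρ) {c : ℝ} (hc : 0 < c) :
    IsUnit (correctedOp hA ρ c) := by
  obtain ⟨κ, hκ, h⟩ := correctedOp_coercive hA hρ hc
  refine ContinuousLinearMap.isUnit_of_forall_le_norm_inner_map _ (c := ⟨κ, hκ.le⟩) hκ fun u => ?_
  calc ‖u‖ ^ 2 * κ ≤ (inner ℂ u (correctedOp hA ρ c u)).re := by linarith [h u]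
    _ ≤ ‖inner ℂ u (correctedOp hA ρ c u)‖ := Complex.re_le_norm _
    _ = ‖inner ℂ (correctedOp hA ρ c u) u‖ := norm_inner_symm _ _

/-- On mean-zero functions the rank-one correction vanishes, so `u - M(u)` lies in the kernel of the
injective corrected operator. -/
theorem eq_smul_one_of_cellOp_eq_zero (hA : IsCoefficient A) (hρ : 0 < ρ) {u : H2 d}
    (hu : cellOp hA ρ u = 0) : u = H2.mean d u • H2.one d := by
  have hm : H2.mean d (u - H2.mean d u • H2.one d) = 0 := by
    rw [map_sub, map_smul, H2.mean_one, smul_eq_mul, mul_one, sub_self]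
  have h : correctedOp hA ρ 1 (u - H2.mean d u • H2.one d) = 0 := by
    rw [correctedOp, add_apply, ContinuousLinearMap.smulRight_apply, hm,
      zero_smul, map_sub, map_smul, hu, cellOp_one, smul_zero, sub_zero, add_zero]
  have hinj := (ContinuousLinearMap.isUnit_iff_bijective.1 (isUnit_correctedOp hA hρ one_pos)).1
  exact sub_eq_zero.1 (hinj (h.trans (map_zero _).symm))

theorem solvesCellProblem_iff_cellOp (hA : IsCoefficient A) {l : Fin d} {χ : H2 d} :
    SolvesCellProblem A ρ l χ ↔ H2.mean d χ = 0 ∧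
      cellOp hA ρ χ = -∑ j, ContinuousLinearMap.adjoint (H2.gradL j)
        (coeffMul hA j l (oneL2 d)) := by
  rw [solvesCellProblem_iff hA]
  refine and_congr_right fun _ => ?_
  rw [← sub_eq_zero, ext_iff_inner_left ℂ]
  refine forall_congr' fun v => ?_
  have h1 : coeffForm hA (fun j => H2.gradL j v)
      (fun k => (if k = l then oneL2 d else 0) + H2.gradL k χ) =
      ∑ j, inner ℂ (H2.gradL j v) (coeffMul hA j l (oneL2 d)) +
        coeffForm hA (fun j => H2.gradL j v) (fun k => H2.gradL k χ) := by
    simp only [coeffForm, map_add, inner_add_right, Finset.sum_add_distrib]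
    congr 1
    refine Finset.sum_congr rfl fun j _ => ?_
    rw [Finset.sum_eq_single l]
    · simp
    · intro k _ hk
      simp [hk]
    · simp
  rw [h1, inner_zero_right, sub_neg_eq_add, inner_add_right, inner_sum, inner_cellOp]
  simp_rw [ContinuousLinearMap.adjoint_inner_right]
  rw [show ∀ a b c : ℂ, a + (b + c) = c + a + b from fun a b c => by ring]

/-- The corrected operator is inverted instead of the degenerate cell operator. Testing with `1`
kills the right-hand side and forces mean zero, so the correction disappears from the equation. -/
theorem existsUnique_solvesCellProblem (hA : IsCoefficient A) (hρ : 0 < ρ) (l : Fin d) :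
    ∃! χ : H2 d, SolvesCellProblem A ρ l χ := by
  simp_rw [solvesCellProblem_iff_cellOp hA]
  have hbij := ContinuousLinearMap.isUnit_iff_bijective.1 (isUnit_correctedOp hA hρ one_pos)
  obtain ⟨χ, hχ⟩ := hbij.2 (-∑ j, ContinuousLinearMap.adjoint (H2.gradL j)
        (coeffMul hA j l (oneL2 d)))
  have hmean : H2.mean d χ = 0 := by
    have h1 := congrArg (inner ℂ (H2.one d)) hχ
    rw [inner_correctedOp, inner_cellOp, inner_neg_right, inner_sum] at h1
    simp_rw [ContinuousLinearMap.adjoint_inner_right] at h1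
    have hV : (volume.real (cell d) : ℂ) ≠ 0 := by exact_mod_cast (volume_real_cell_pos d).ne'
    simpa [H2.gradL_one, H2.laplacianL_one, coeffForm, H2.mean_one, hV] using h1
  refine ⟨χ, ⟨hmean, ?_⟩, fun χ' h' => hbij.1 ?_⟩
  · rwa [correctedOp, add_apply, ContinuousLinearMap.smulRight_apply, hmean,
      zero_smul, add_zero] at hχ
  · rw [hχ, correctedOp, add_apply, ContinuousLinearMap.smulRight_apply, h'.1,
      zero_smul, add_zero, h'.2]

/-! ### The bifurcation equation -/

/-- The trial function `c + z - M_Y(z)`. -/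
def trial (c : ℝ) (z : H2 d) : H2 d := (c : ℂ) • H2.one d + z - H2.mean d z • H2.one d

/-- The eigenvalue equation for the pair of eigenvalue `-M_Y(z)` and eigenfunction
`c + z - M_Y(z)`. -/
def residual (hA : IsCoefficient A) (ρ c : ℝ) (x : EuclideanSpace ℝ (Fin d) × H2 d) : H2 d :=
  blochOp hA ρ x.1 (trial c x.2) +
    H2.mean d x.2 • ContinuousLinearMap.adjoint (H2.toL2L d) (H2.toL2L d (trial c x.2))

theorem contDiff_trial {n : WithTop ℕ∞} (c : ℝ) : ContDiff ℝ n (trial (d := d) c) := by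
  unfold trial
  exact (contDiff_const.add contDiff_id).sub ((contDiff_clm _ contDiff_id).fun_smul contDiff_const)

theorem mean_trial (c : ℝ) (z : H2 d) : H2.mean d (trial c z) = c := by
  simp [trial, H2.mean_one]

theorem trial_zero (c : ℝ) : trial c (0 : H2 d) = (c : ℂ) • H2.one d := by
  simp [trial]

theorem contDiff_residual {n : WithTop ℕ∞} (hA : IsCoefficient A) (c : ℝ) :
    ContDiff ℝ n (residual hA ρ c) := by
  unfold residual
  have h1 := (contDiff_trial (d := d) (n := n) c).comp
    (contDiff_snd (𝕜 := ℝ) (E := EuclideanSpace ℝ (Fin d)))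
  exact (contDiff_blochOp hA contDiff_fst h1).add
    ((contDiff_clm _ contDiff_snd).fun_smul (contDiff_clm _ (contDiff_clm _ h1)))

theorem residual_zero (hA : IsCoefficient A) (c : ℝ) : residual hA ρ c 0 = 0 := by
  simp [residual, trial_zero, blochOp_zero, cellOp_one]

/-- At `η = 0` the constants in the trial function are annihilated by the cell operator. In the
product term `M(0) = 0`, so only the derivative of `M`, times the trial function `c`, survives. -/
theorem hasFDerivAt_residual_snd (hA : IsCoefficient A) (c : ℝ) :
    HasFDerivAt (fun z => residual hA ρ c (0, z)) ((correctedOp hA ρ c).restrictScalars ℝ) 0 := by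
  have h1 : ∀ z, residual hA ρ c (0, z) = cellOp hA ρ z + H2.mean d z •
      ContinuousLinearMap.adjoint (H2.toL2L d) (H2.toL2L d (trial c z)) := by
    intro z
    simp [residual, trial, blochOp_zero, cellOp_one]
  simp_rw [h1]
  have h2 : HasFDerivAt (fun z => H2.mean d z) (H2.mean d) (0 : H2 d) := (H2.mean d).hasFDerivAt
  have h3 : HasFDerivAt (fun z => ContinuousLinearMap.adjoint (H2.toL2L d)
      (H2.toL2L d (trial c z)))
      ((ContinuousLinearMap.adjoint (H2.toL2L d) ∘L H2.toL2L d) ∘L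
        (ContinuousLinearMap.id ℂ (H2 d) - (H2.mean d).smulRight (H2.one d))) (0 : H2 d) := by
    refine (ContinuousLinearMap.adjoint (H2.toL2L d) ∘L H2.toL2L d).hasFDerivAt.comp _ ?_
    unfold trial
    exact ((hasFDerivAt_id _).const_add _).sub
      ((H2.mean d).smulRight (H2.one d)).hasFDerivAt
  have h4 := (cellOp hA ρ).hasFDerivAt.add (h2.smul h3)
  refine (h4.congr_fderiv ?_).restrictScalars ℝ
  rw [map_zero, zero_smul, zero_add, trial_zero, map_smul, map_smul, H2.toL2L_one]
  rfl

theorem exists_residual_solution (hA : IsCoefficient A) (hρ : 0 < ρ) {c : ℝ} (hc : 0 < c) :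
    ∃ g : EuclideanSpace ℝ (Fin d) → H2 d, AnalyticAt ℝ g 0 ∧ g 0 = 0 ∧
      ∀ᶠ η in 𝓝 0, residual hA ρ c (η, g η) = 0 := by
  have hR : ContDiffAt ℝ ω (residual hA ρ c) 0 := (contDiff_residual hA c).contDiffAt
  have hd : fderiv ℝ (residual hA ρ c) 0 ∘L .inr ℝ (EuclideanSpace ℝ (Fin d)) (H2 d) =
      (correctedOp hA ρ c).restrictScalars ℝ := by
    refine HasFDerivAt.unique ?_ (hasFDerivAt_residual_snd hA c)
    have h1 : HasFDerivAt (residual hA ρ c) (fderiv ℝ (residual hA ρ c) 0)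
        (ContinuousLinearMap.inr ℝ (EuclideanSpace ℝ (Fin d)) (H2 d) 0) := by
      rw [map_zero]
      exact (hR.differentiableAt (by simp)).hasFDerivAt
    exact h1.comp (0 : H2 d)
      (ContinuousLinearMap.inr ℝ (EuclideanSpace ℝ (Fin d)) (H2 d)).hasFDerivAt
  have hinv : (fderiv ℝ (residual hA ρ c) 0 ∘L
      .inr ℝ (EuclideanSpace ℝ (Fin d)) (H2 d)).IsInvertible := by
    rw [hd]
    obtain ⟨e, he⟩ := isUnit_correctedOp hA hρ hc
    refine ⟨(ContinuousLinearEquiv.ofUnit e).restrictScalars ℝ, ?_⟩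
    rw [← he]
    rfl
  refine ⟨hR.implicitFunction (by simp) hinv, ?_, hR.implicitFunction_apply_self (by simp) hinv, ?_⟩
  · exact (hR.contDiffAt_implicitFunction (by simp) hinv).analyticAt
  · have := hR.eventually_apply_implicitFunction (by simp) hinv
    rwa [residual_zero] at this

/-! ### The first eigenvalue -/

theorem toL2L_ne_zero_of_mean_ne_zero {u : H2 d} (hu : H2.mean d u ≠ 0) : H2.toL2L d u ≠ 0 := by
  intro h
  exact hu (by rw [H2.mean_eq, h, map_zero])

theorem ofReal_norm_sq (f : L2 d) : inner ℂ f f = ((‖f‖ ^ 2 : ℝ) : ℂ) := by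
  rw [inner_self_eq_norm_sq_to_K]
  simp

theorem blochForm_sub_smul (hA : IsCoefficient A) (η : EuclideanSpace ℝ (Fin d)) (u w v : H2 d)
    (a b : ℂ) : blochForm A ρ η (a • u - b • w) v =
      a * blochForm A ρ η u v - b * blochForm A ρ η w v := by
  have h1 : ∀ j, H2.shiftedGrad η (a • u - b • w) j =
      a • H2.shiftedGrad η u j - b • H2.shiftedGrad η w j := by
    intro j
    simp only [H2.shiftedGrad_eq, map_sub, map_smul]
    module
  have h2 : H2.shiftedLaplacian η (a • u - b • w) =
      a • H2.shiftedLaplacian η u - b • H2.shiftedLaplacian η w := by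
    simp only [H2.shiftedLaplacian_eq, map_sub, map_smul, smul_sub, smul_add, Finset.smul_sum,
      Finset.sum_sub_distrib, smul_comm _ a, smul_comm _ b]
    module
  simp only [blochForm_eq hA, h2, coeffForm, h1, map_sub, map_smul, inner_sub_right,
    inner_smul_right, Finset.sum_sub_distrib, ← Finset.mul_sum]
  ring

/-- The Fourier coefficients of `u` determine those of all its derivatives, so `H² → L²` is
injective. -/
theorem toL2L_ne_zero {u : H2 d} (hu : u ≠ 0) : H2.toL2L d u ≠ 0 := by
  intro h
  have hz : ∀ n, fourierCoeff u.toL2 n = 0 := fun n => by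
    rw [← H2.toL2L_apply, h, fourierCoeff_zero]
  have hL2 : ∀ f : L2 d, (∀ n, fourierCoeff f n = 0) → ‖f‖ ^ 2 = 0 := by
    intro f hf
    have h1 := hasSum_sq_fourierCoeff f
    simp only [hf, norm_zero, ne_eq, OfNat.ofNat_ne_zero, not_false_eq_true, zero_pow] at h1
    have h2 := h1.unique hasSum_zero
    exact (mul_eq_zero.1 h2).resolve_left (inv_ne_zero (volume_real_cell_pos d).ne')
  have h3 := H2.norm_sq_eq u
  rw [hL2 _ hz, Finset.sum_eq_zero fun j _ => hL2 _ fun n => by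
    rw [H2.fourierCoeff_grad, hz, mul_zero], Finset.sum_eq_zero fun j _ => Finset.sum_eq_zero
    fun k _ => hL2 _ fun n => by rw [H2.fourierCoeff_hess, hz, mul_zero]] at h3
  exact hu (by simpa using h3)

theorem SolvesBloch.inner_eq_zero (hA : IsCoefficient A) {η : EuclideanSpace ℝ (Fin d)}
    {μ ν : ℝ} {u w : H2 d} (hu : SolvesBloch A ρ η μ u) (hw : SolvesBloch A ρ η ν w)
    (hne : μ ≠ ν) : inner ℂ (H2.toL2L d u) (H2.toL2L d w) = 0 := by
  rw [solvesBloch_iff] at hu hw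
  have h1 := hw u
  have h2 := congrArg conj (hu w)
  rw [blochForm_conj hA, map_mul, Complex.conj_ofReal, inner_conj_symm, h1] at h2
  have h3 : ((ν : ℂ) - μ) * inner ℂ (H2.toL2L d u) (H2.toL2L d w) = 0 := by linear_combination h2
  exact (mul_eq_zero.1 h3).resolve_left (sub_ne_zero.2 (by exact_mod_cast hne.symm))

/-- The energy controls the `L²` norm on functions of vanishing mean. -/
theorem re_blochForm_ge_of_mean_eq_zero (hA : IsCoefficient A) {α : ℝ} (hα : 0 < α)
    (h : ∀ᵐ y, ∀ ξ : Fin d → ℝ, α * ∑ j, ξ j ^ 2 ≤ ∑ j, ∑ k, A y j k * ξ k * ξ j)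
    {η : EuclideanSpace ℝ (Fin d)} (hη : ∀ j, |η j| ≤ 1 / 2) {u : H2 d} (hu : H2.mean d u = 0) :
    α / 4 * ‖H2.toL2L d u‖ ^ 2 ≤ (blochForm A ρ η u u).re := by
  have h1 := re_blochForm_ge (ρ := ρ) hA h η u
  have h2 := H2.norm_sq_toL2_le η hη u
  rw [hu, norm_zero, zero_pow two_ne_zero, mul_zero, zero_add] at h2
  have h3 : 0 ≤ ρ ^ 2 * ‖H2.shiftedLaplacian η u‖ ^ 2 := by positivity
  rw [H2.toL2L_apply]
  nlinarith

/-- An eigenvalue below `α / 4` whose eigenfunction has nonvanishing mean is the smallest one. -/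
theorem isLeast_of_solvesBloch (hA : IsCoefficient A) {α : ℝ} (hα : 0 < α)
    (h : ∀ᵐ y, ∀ ξ : Fin d → ℝ, α * ∑ j, ξ j ^ 2 ≤ ∑ j, ∑ k, A y j k * ξ k * ξ j)
    {η : EuclideanSpace ℝ (Fin d)} (hη : ∀ j, |η j| ≤ 1 / 2) {lam : ℝ} (hlam : lam < α / 4)
    {φ : H2 d} (hφ : SolvesBloch A ρ η lam φ) (hmean : H2.mean d φ ≠ 0) :
    IsLeast (blochEigenvalues A ρ η) lam := by
  refine ⟨⟨φ, fun h0 => hmean (by rw [h0, map_zero]), hφ⟩, ?_⟩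
  rintro μ ⟨u, hu0, hu⟩
  by_contra! hlt
  have horth := SolvesBloch.inner_eq_zero hA hφ hu hlt.ne'
  rw [solvesBloch_iff] at hφ hu
  set a := H2.mean d φ
  set b := H2.mean d u
  -- This combination of the two eigenfunctions has mean zero, so the lower bound `α/4` applies to
  -- it.
  set z := a • u - b • φ with hz
  have hzm : H2.mean d z = 0 := by
    simp only [hz, map_sub, map_smul, smul_eq_mul, a, b]
    ring
  have hzL : H2.toL2L d z = a • H2.toL2L d u - b • H2.toL2L d φ := by
    rw [hz, map_sub, map_smul, map_smul]
  have h1 : blochForm A ρ η z z =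
      lam * inner ℂ (H2.toL2L d z) (H2.toL2L d z) +
        (μ - lam) * (a * inner ℂ (H2.toL2L d z) (H2.toL2L d u)) := by
    have e1 : blochForm A ρ η z z = a * (μ * inner ℂ (H2.toL2L d z) (H2.toL2L d u)) -
        b * (lam * inner ℂ (H2.toL2L d z) (H2.toL2L d φ)) := by
      rw [← hu z, ← hφ z, ← blochForm_sub_smul hA]
    have e2 : inner ℂ (H2.toL2L d z) (H2.toL2L d z) = a * inner ℂ (H2.toL2L d z) (H2.toL2L d u) -
        b * inner ℂ (H2.toL2L d z) (H2.toL2L d φ) := by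
      conv_lhs => rw [hzL, inner_sub_right, inner_smul_right, inner_smul_right, ← hzL]
    rw [e1, e2]
    ring
  -- Orthogonality makes the cross term real and positive, so `μ < lam` pushes the energy of `z`
  -- strictly below `lam ‖z‖²`, contradicting the lower bound.
  have h2 : a * inner ℂ (H2.toL2L d z) (H2.toL2L d u) =
      ((‖a‖ ^ 2 * ‖H2.toL2L d u‖ ^ 2 : ℝ) : ℂ) := by
    rw [hzL, inner_sub_left, inner_smul_left, inner_smul_left, horth, ofReal_norm_sq, mul_zero,
      sub_zero, ← mul_assoc, Complex.mul_conj, Complex.normSq_eq_norm_sq]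
    push_cast
    ring
  have h3 := re_blochForm_ge_of_mean_eq_zero (ρ := ρ) hA hα h hη hzm
  have h4 : (blochForm A ρ η z z).re = lam * ‖H2.toL2L d z‖ ^ 2 +
      (μ - lam) * (‖a‖ ^ 2 * ‖H2.toL2L d u‖ ^ 2) := by
    rw [h1, h2, ofReal_norm_sq]
    norm_cast
  rw [h4] at h3
  have h5 : 0 < ‖a‖ ^ 2 * ‖H2.toL2L d u‖ ^ 2 := by
    have := norm_pos_iff.2 hmean
    have := norm_pos_iff.2 (toL2L_ne_zero hu0)
    positivity
  nlinarith [mul_nonneg (sub_nonneg.2 hlam.le) (sq_nonneg ‖H2.toL2L d z‖),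
    mul_pos (sub_pos.2 hlt) h5]

theorem solvesBloch_trial (hA : IsCoefficient A) {c : ℝ} (hc : 0 < c)
    {η : EuclideanSpace ℝ (Fin d)} {z : H2 d} (h : residual hA ρ c (η, z) = 0) :
    SolvesBloch A ρ η (-(H2.mean d z).re) (trial c z) := by
  have h1 : ∀ v, blochForm A ρ η (trial c z) v =
      -H2.mean d z * inner ℂ (H2.toL2L d v) (H2.toL2L d (trial c z)) := by
    intro v
    have h2 := congrArg (inner ℂ v) h
    rw [residual, inner_add_right, inner_blochOp, H2.inner_smul_right,
      ContinuousLinearMap.adjoint_inner_right, inner_zero_right] at h2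
    linear_combination h2
  -- The number `-M(z)` is a priori complex; testing the Hermitian form on the eigenfunction itself
  -- makes it real.
  have h3 : conj (H2.mean d z) = H2.mean d z := by
    have h4 := h1 (trial c z)
    have h5 := congrArg conj h4
    rw [blochForm_conj hA, h4, ofReal_norm_sq, map_mul, Complex.conj_ofReal, map_neg] at h5
    have h6 : ((‖H2.toL2L d (trial c z)‖ ^ 2 : ℝ) : ℂ) ≠ 0 := by
      have : H2.toL2L d (trial c z) ≠ 0 := toL2L_ne_zero_of_mean_ne_zero <| by
        rw [mean_trial]
        exact_mod_cast hc.ne'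
      exact_mod_cast pow_ne_zero 2 (norm_ne_zero_iff.2 this)
    exact (neg_injective (mul_right_cancel₀ h6 h5)).symm
  rw [solvesBloch_iff]
  intro v
  rw [h1 v]
  congr 1
  rw [Complex.ofReal_neg, Complex.conj_eq_iff_re.1 h3]

/-- The normalization constant `(2π)^{-d/2}`. -/
def normConst (d : ℕ) : ℝ := (2 * Real.pi) ^ (-(d : ℝ) / 2)

theorem normConst_pos (d : ℕ) : 0 < normConst d := Real.rpow_pos_of_pos (by positivity) _

theorem exists_analytic_first_eigenpair (hA : IsCoefficient A) (hρ : 0 < ρ) :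
    ∃ δ : ℝ, 0 < δ ∧
      (∀ η ∈ Metric.ball (0 : EuclideanSpace ℝ (Fin d)) δ,
        IsLeast (blochEigenvalues A ρ η) (firstBlochEigenvalue A ρ η)) ∧
      AnalyticOnNhd ℝ (firstBlochEigenvalue A ρ) (Metric.ball 0 δ) ∧
      ∃ φ : EuclideanSpace ℝ (Fin d) → H2 d, IsFirstBlochEigenfunction A ρ δ φ := by
  have hc := normConst_pos d
  obtain ⟨α, hα, h⟩ := hA.elliptic
  obtain ⟨g, hg, hg0, hgR⟩ := exists_residual_solution hA hρ hc
  have hlam : AnalyticAt ℝ (fun η => -(H2.mean d (g η)).re) 0 :=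
    (((Complex.reCLM ∘L (H2.mean d).restrictScalars ℝ).analyticAt _).comp hg).neg
  have htr : AnalyticAt ℝ (fun η => trial (normConst d) (g η)) 0 :=
    ((contDiff_trial (n := ω) (normConst d)).contDiffAt.analyticAt).comp hg
  -- The branch vanishes at the origin, so by continuity it stays below the threshold of
  -- `isLeast_of_solvesBloch`.
  have hsmall : ∀ᶠ η in 𝓝 (0 : EuclideanSpace ℝ (Fin d)), -(H2.mean d (g η)).re < α / 4 := by
    refine hlam.continuousAt.eventually_lt_const ?_
    simp only [hg0, map_zero, Complex.zero_re, neg_zero]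
    positivity
  have hball : ∀ᶠ η in 𝓝 (0 : EuclideanSpace ℝ (Fin d)), ∀ j, |η j| ≤ 1 / 2 := by
    filter_upwards [Metric.ball_mem_nhds (0 : EuclideanSpace ℝ (Fin d)) (by norm_num :
      (0 : ℝ) < 1 / 2)] with η hη j
    exact (PiLp.norm_apply_le η j).trans (mem_ball_zero_iff.1 hη).le
  obtain ⟨δ, hδ, hall⟩ := Metric.eventually_nhds_iff_ball.1
    (hgR.and (hsmall.and (hball.and (hlam.eventually_analyticAt.and htr.eventually_analyticAt))))
  have hsol := fun η hη => solvesBloch_trial hA hc (hall η hη).1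
  have hmean : ∀ η, H2.mean d (trial (normConst d) (g η)) ≠ 0 := fun η => by
    rw [mean_trial]
    exact_mod_cast hc.ne'
  have hleast : ∀ η ∈ Metric.ball (0 : EuclideanSpace ℝ (Fin d)) δ,
      IsLeast (blochEigenvalues A ρ η) (-(H2.mean d (g η)).re) := fun η hη =>
    isLeast_of_solvesBloch hA hα h (hall η hη).2.2.1 (hall η hη).2.1 (hsol η hη) (hmean η)
  have hfirst : ∀ η ∈ Metric.ball (0 : EuclideanSpace ℝ (Fin d)) δ,
      firstBlochEigenvalue A ρ η = -(H2.mean d (g η)).re := fun η hη => (hleast η hη).csInf_eq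
  refine ⟨δ, hδ, fun η hη => ?_, fun η hη => ?_, fun η => trial (normConst d) (g η), ?_, ?_, ?_⟩
  · rw [hfirst η hη]
    exact hleast η hη
  · refine (hall η hη).2.2.2.1.congr ?_
    filter_upwards [Metric.isOpen_ball.mem_nhds hη] with ξ hξ
    exact (hfirst ξ hξ).symm
  · exact fun η hη => (hall η hη).2.2.2.2
  · intro η hη
    rw [hfirst η hη]
    exact hsol η hη
  · intro η _
    rw [← H2.mean_eq_cellMean, mean_trial]
    rfl

/-! ### Nonnegativity, and value and gradient at the origin -/

theorem blochEigenvalues_nonneg (hA : IsCoefficient A) {η : EuclideanSpace ℝ (Fin d)} {μ : ℝ}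
    (hμ : μ ∈ blochEigenvalues A ρ η) : 0 ≤ μ := by
  obtain ⟨α, hα, h⟩ := hA.elliptic
  obtain ⟨u, hu0, hu⟩ := hμ
  have h1 := re_blochForm_ge (ρ := ρ) hA h η u
  rw [solvesBloch_iff.1 hu u, ofReal_norm_sq, ← Complex.ofReal_mul, Complex.ofReal_re] at h1
  have h2 : 0 ≤ α * ∑ j, ‖H2.shiftedGrad η u j‖ ^ 2 + ρ ^ 2 * ‖H2.shiftedLaplacian η u‖ ^ 2 := by
    have := Finset.sum_nonneg fun j (_ : j ∈ Finset.univ) => sq_nonneg ‖H2.shiftedGrad η u j‖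
    positivity
  exact nonneg_of_mul_nonneg_left (h2.trans h1)
    (pow_pos (norm_pos_iff.2 (toL2L_ne_zero hu0)) 2)

theorem firstBlochEigenvalue_nonneg (hA : IsCoefficient A) (η : EuclideanSpace ℝ (Fin d)) :
    0 ≤ firstBlochEigenvalue A ρ η :=
  -- This holds for every `η`, even without eigenvalues, since the real infimum of the empty set is
  -- `0`.
  Real.sInf_nonneg fun _ => blochEigenvalues_nonneg hA

theorem firstBlochEigenvalue_zero (hA : IsCoefficient A) : firstBlochEigenvalue A ρ 0 = 0 := by
  refine le_antisymm (csInf_le ⟨0, fun _ => blochEigenvalues_nonneg hA⟩ ⟨H2.one d, ?_, ?_⟩)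
    (firstBlochEigenvalue_nonneg hA 0)
  · intro h
    have := H2.mean_one (d := d)
    rw [h, map_zero] at this
    exact zero_ne_one this
  · rw [solvesBloch_iff]
    intro v
    rw [← inner_blochOp hA, blochOp_zero, cellOp_one]
    simp

/-- The origin is a global minimum, so Fermat's rule applies. -/
theorem partialEta_firstBlochEigenvalue (hA : IsCoefficient A) (l : Fin d) :
    partialEta l (firstBlochEigenvalue A ρ) 0 = 0 := by
  have h : IsLocalMin (firstBlochEigenvalue A ρ) (0 : EuclideanSpace ℝ (Fin d)) :=
    Filter.Eventually.of_forall fun η => by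
      rw [firstBlochEigenvalue_zero hA]
      exact firstBlochEigenvalue_nonneg hA η
  rw [partialEta, h.fderiv_eq_zero]
  rfl

/-! ### Derivatives along lines through the origin -/

theorem hasDerivAt_clm {E F : Type*} [NormedAddCommGroup E] [NormedSpace ℂ E] [NormedSpace ℝ E]
    [IsScalarTower ℝ ℂ E] [NormedAddCommGroup F] [NormedSpace ℂ F] [NormedSpace ℝ F]
    [IsScalarTower ℝ ℂ F] (T : E →L[ℂ] F) {f : ℝ → E} {f' : E} {x : ℝ}
    (hf : HasDerivAt f f' x) : HasDerivAt (fun t => T (f t)) (T f') x :=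
  (T.restrictScalars ℝ).hasFDerivAt.comp_hasDerivAt x hf

theorem hasDerivAt_coord (e : EuclideanSpace ℝ (Fin d)) (j : Fin d) (t : ℝ) :
    HasDerivAt (fun t : ℝ => (((t • e) j : ℝ) : ℂ)) (e j : ℂ) t := by
  have h : HasDerivAt (fun t : ℝ => (t • e) j) (e j) t := by
    simpa using (hasDerivAt_id t).mul_const (e j)
  exact h.ofReal_comp

theorem hasDerivAt_shiftedGrad (e : EuclideanSpace ℝ (Fin d)) {u : ℝ → H2 d} {ψ : H2 d}
    (hu : HasDerivAt u ψ 0) (j : Fin d) :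
    HasDerivAt (fun t : ℝ => H2.shiftedGrad (t • e) (u t) j)
      (H2.gradL j ψ + (Complex.I * (e j : ℂ)) • H2.toL2L d (u 0)) 0 := by
  simp_rw [H2.shiftedGrad_eq]
  have h := (hasDerivAt_clm (H2.gradL j) hu).fun_add
    (((hasDerivAt_coord e j 0).const_mul Complex.I).fun_smul (hasDerivAt_clm (H2.toL2L d) hu))
  simpa using h

theorem hasDerivAt_shiftedLaplacian (e : EuclideanSpace ℝ (Fin d)) {u : ℝ → H2 d} {ψ : H2 d}
    (hu : HasDerivAt u ψ 0) :
    HasDerivAt (fun t : ℝ => H2.shiftedLaplacian (t • e) (u t))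
      (H2.laplacianL d ψ + ∑ j, (2 * Complex.I * (e j : ℂ)) • H2.gradL j (u 0)) 0 := by
  simp_rw [H2.shiftedLaplacian_eq]
  -- The `|η|²` term is quadratic and drops out at first order.
  have hn : HasDerivAt (fun t : ℝ => ((‖t • e‖ ^ 2 : ℝ) : ℂ)) 0 0 := by
    have h0 : HasDerivAt (fun t : ℝ => t ^ 2 * ‖e‖ ^ 2) 0 0 := by
      simpa using (hasDerivAt_pow 2 (0 : ℝ)).mul_const (‖e‖ ^ 2)
    have h1 : HasDerivAt (fun t : ℝ => ‖t • e‖ ^ 2) 0 0 := by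
      simpa [norm_smul, mul_pow] using h0
    simpa using h1.ofReal_comp
  have h := ((hasDerivAt_clm (H2.laplacianL d) hu).fun_add
    (HasDerivAt.fun_sum (u := Finset.univ) fun j _ =>
      ((hasDerivAt_coord e j 0).const_mul (2 * Complex.I)).fun_smul
        (hasDerivAt_clm (H2.gradL j) hu))).fun_sub
    (hn.fun_smul (hasDerivAt_clm (H2.toL2L d) hu))
  simpa using h

/-- The derivative of the Bloch form at `η = 0` along a curve starting at a constant. -/
theorem hasDerivAt_blochForm (hA : IsCoefficient A) (e : EuclideanSpace ℝ (Fin d))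
    {u : ℝ → H2 d} {ψ : H2 d} (hu : HasDerivAt u ψ 0) {c : ℂ} (hu0 : u 0 = c • H2.one d)
    (v : H2 d) :
    HasDerivAt (fun t : ℝ => blochForm A ρ (t • e) (u t) v)
      (inner ℂ v (cellOp hA ρ ψ) + ∑ j, ∑ k, Complex.I * e k * c *
        inner ℂ (H2.gradL j v) (coeffMul hA j k (oneL2 d))) 0 := by
  simp_rw [blochForm_eq hA, coeffForm]
  have hv := hasDerivAt_const (0 : ℝ) v
  have h := (HasDerivAt.fun_sum (u := Finset.univ) fun j _ =>
    HasDerivAt.fun_sum (u := Finset.univ) fun k _ =>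
    (hasDerivAt_shiftedGrad e hv j).inner ℂ
      (hasDerivAt_clm (coeffMul hA j k) (hasDerivAt_shiftedGrad e hu k))).fun_add
    (((hasDerivAt_shiftedLaplacian e hv).inner ℂ
      (hasDerivAt_shiftedLaplacian e hu)).const_mul ((ρ : ℂ) ^ 2))
  refine h.congr_deriv ?_
  -- Since `u 0` is constant, every term with its gradient or Laplacian vanishes, including those
  -- where the derivative falls on the shift of the test function.
  simp only [zero_smul, shiftedGrad_zero, shiftedLaplacian_zero, hu0, map_smul, H2.gradL_one,
    H2.laplacianL_one, H2.toL2L_one, smul_zero, map_zero, inner_zero_right, add_zero,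
    Finset.sum_const_zero, map_add, inner_add_right, inner_smul_right, inner_cellOp, coeffForm,
    Finset.sum_add_distrib]
  simp only [mul_assoc]
  ring

theorem hasDerivAt_line {F : Type*} [NormedAddCommGroup F] [NormedSpace ℝ F]
    {f : EuclideanSpace ℝ (Fin d) → F} (hf : DifferentiableAt ℝ f 0) (l : Fin d) :
    HasDerivAt (fun t : ℝ => f (t • EuclideanSpace.single l 1)) (partialEta l f 0) 0 := by
  have h1 : HasDerivAt (fun t : ℝ => t • (EuclideanSpace.single l 1 : EuclideanSpace ℝ (Fin d)))
      (EuclideanSpace.single l 1) 0 := by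
    simpa using (hasDerivAt_id (0 : ℝ)).smul_const
      (EuclideanSpace.single l 1 : EuclideanSpace ℝ (Fin d))
  have h2 : HasFDerivAt f (fderiv ℝ f 0)
      ((0 : ℝ) • (EuclideanSpace.single l 1 : EuclideanSpace ℝ (Fin d))) := by
    rw [zero_smul]
    exact hf.hasFDerivAt
  exact h2.comp_hasDerivAt 0 h1

/-! ### The eigenfunction to first order -/

variable {δ : ℝ} {φ : EuclideanSpace ℝ (Fin d) → H2 d}

theorem IsFirstBlochEigenfunction.mean_eq (h : IsFirstBlochEigenfunction A ρ δ φ)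
    {η : EuclideanSpace ℝ (Fin d)} (hη : η ∈ Metric.ball 0 δ) :
    H2.mean d (φ η) = normConst d := by
  rw [H2.mean_eq_cellMean, h.normalized η hη]
  rfl

theorem IsFirstBlochEigenfunction.apply_zero (h : IsFirstBlochEigenfunction A ρ δ φ)
    (hA : IsCoefficient A) (hρ : 0 < ρ) (hδ : 0 < δ) :
    φ 0 = (normConst d : ℂ) • H2.one d := by
  have h0 : (0 : EuclideanSpace ℝ (Fin d)) ∈ Metric.ball 0 δ := Metric.mem_ball_self hδ
  have h1 : cellOp hA ρ (φ 0) = 0 := by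
    refine ext_inner_left ℂ fun v => ?_
    have h2 := solvesBloch_iff.1 (h.solves 0 h0) v
    rw [firstBlochEigenvalue_zero hA, ← inner_blochOp hA, blochOp_zero, Complex.ofReal_zero,
      zero_mul] at h2
    rw [h2, inner_zero_right]
  rw [← h.mean_eq h0]
  exact eq_smul_one_of_cellOp_eq_zero hA hρ h1

/-- The first-order weak equation has no eigenvalue term, because the eigenvalue and its gradient
vanish at `0`. What remains is the cell problem scaled by `i c`, whose solutions differ by
constants. -/
theorem IsFirstBlochEigenfunction.partialEta_eq (h : IsFirstBlochEigenfunction A ρ δ φ)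
    (hA : IsCoefficient A) (hρ : 0 < ρ) (hδ : 0 < δ) {l : Fin d} {χ : H2 d}
    (hχ : SolvesCellProblem A ρ l χ) :
    ∃ k : ℂ, partialEta l φ 0 = (Complex.I * normConst d) • χ + k • H2.one d := by
  have h0 : (0 : EuclideanSpace ℝ (Fin d)) ∈ Metric.ball 0 δ := Metric.mem_ball_self hδ
  set e : EuclideanSpace ℝ (Fin d) := EuclideanSpace.single l 1 with he
  set ψ := partialEta l φ 0 with hψ
  have hu : HasDerivAt (fun t : ℝ => φ (t • e)) ψ 0 :=
    hasDerivAt_line (h.analytic 0 h0).differentiableAt l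
  have hu0 : φ ((0 : ℝ) • e) = (normConst d : ℂ) • H2.one d := by
    rw [zero_smul]
    exact h.apply_zero hA hρ hδ
  have hlam : HasDerivAt (fun t : ℝ => (firstBlochEigenvalue A ρ (t • e) : ℂ)) 0 0 := by
    obtain ⟨δ', hδ', -, han, -⟩ := exists_analytic_first_eigenpair hA hρ
    have h1 := hasDerivAt_line (han 0 (Metric.mem_ball_self hδ')).differentiableAt l
    rw [partialEta_firstBlochEigenvalue hA] at h1
    simpa using h1.ofReal_comp
  have hline : ∀ᶠ t : ℝ in 𝓝 0, t • e ∈ Metric.ball (0 : EuclideanSpace ℝ (Fin d)) δ := by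
    have hcont : Continuous fun t : ℝ => t • e := by fun_prop
    refine hcont.continuousAt.eventually_mem (Metric.isOpen_ball.mem_nhds ?_)
    rwa [zero_smul]
  have hweak : cellOp hA ρ ψ = cellOp hA ρ ((Complex.I * normConst d) • χ) := by
    refine ext_inner_left ℂ fun v => ?_
    have d1 := hasDerivAt_blochForm (ρ := ρ) hA e hu hu0 v
    have d2 := hlam.fun_mul ((hasDerivAt_const (0 : ℝ) (H2.toL2L d v)).inner ℂ
      (hasDerivAt_clm (H2.toL2L d) hu))
    have d3 := d1.unique (d2.congr_of_eventuallyEq ?_)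
    · rw [zero_smul, firstBlochEigenvalue_zero hA, Complex.ofReal_zero, zero_mul, zero_mul,
        add_zero] at d3
      rw [map_smul, ((solvesCellProblem_iff_cellOp hA).1 hχ).2, H2.inner_smul_right,
        inner_neg_right, inner_sum, eq_neg_of_add_eq_zero_left d3, mul_neg, Finset.mul_sum]
      congr 1
      refine Finset.sum_congr rfl fun j _ => ?_
      rw [Finset.sum_eq_single l, ContinuousLinearMap.adjoint_inner_right]
      · simp [he]
      · intro k _ hk
        simp [he, hk]
      · simp
    · filter_upwards [hline] with t ht
      exact solvesBloch_iff.1 (h.solves _ ht) v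
  have h3 : cellOp hA ρ (ψ - (Complex.I * normConst d) • χ) = 0 := by
    rw [map_sub, hweak, sub_self]
  exact ⟨_, sub_eq_iff_eq_add'.1 (eq_smul_one_of_cellOp_eq_zero hA hρ h3)⟩

theorem IsFirstBlochEigenfunction.partialEta_sub_const (h : IsFirstBlochEigenfunction A ρ δ φ)
    (hA : IsCoefficient A) (hρ : 0 < ρ) (hδ : 0 < δ) {l : Fin d} {χ : H2 d}
    (hχ : SolvesCellProblem A ρ l χ) :
    ∃ c : ℂ, ∀ᵐ y ∂(volume.restrict (cell d)),
      (partialEta l φ 0).toL2 y - Complex.I * (φ 0).toL2 y * χ.toL2 y = c := by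
  obtain ⟨k, hk⟩ := h.partialEta_eq hA hρ hδ hχ
  refine ⟨k, ?_⟩
  have h1 : (partialEta l φ 0).toL2 = (Complex.I * normConst d) • χ.toL2 + k • oneL2 d := by
    rw [hk]
    rfl
  have h2 : (φ 0).toL2 = (normConst d : ℂ) • oneL2 d := by
    rw [h.apply_zero hA hρ hδ]
    rfl
  rw [h1, h2]
  filter_upwards [Lp.coeFn_add ((Complex.I * normConst d) • χ.toL2) (k • oneL2 d),
    Lp.coeFn_smul (Complex.I * normConst d : ℂ) χ.toL2, Lp.coeFn_smul k (oneL2 d),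
    Lp.coeFn_smul (normConst d : ℂ) (oneL2 d), coeFn_oneL2 d] with y h3 h4 h5 h6 h7
  simp only [h3, h4, h5, h6, h7, Pi.add_apply, Pi.smul_apply, smul_eq_mul]
  ring

/-! ### The homogenized matrix -/

theorem inner_cellOp_conj (hA : IsCoefficient A) (u v : H2 d) :
    conj (inner ℂ v (cellOp hA ρ u)) = inner ℂ u (cellOp hA ρ v) := by
  rw [← blochOp_zero, ← blochOp_zero, inner_blochOp, inner_blochOp, blochForm_conj hA]

/-- Uniqueness of the cell problem makes each corrector equal to its own conjugate. -/
theorem homogenizedMatrix_conj (hA : IsCoefficient A) (hρ : 0 < ρ) {χ : Fin d → H2 d}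
    (hχ : ∀ l, SolvesCellProblem A ρ l (χ l)) (k l : Fin d) :
    conj (homogenizedMatrix A χ k l) = homogenizedMatrix A χ k l := by
  have hreal : (χ l).conjugate = χ l :=
    (existsUnique_solvesCellProblem hA hρ l).unique ((hχ l).conjugate hA) (hχ l)
  have hg : ∀ j, star (H2.gradL j (χ l)) = H2.gradL j (χ l) := fun j => by
    rw [← H2.gradL_conjugate, hreal]
  simp_rw [homogenizedMatrix_eq hA, map_add, map_sum, ← meanL2_star, ← coeffMul_star, hg,
    star_oneL2]

theorem homogenizedMatrix_symm (hA : IsCoefficient A) (hρ : 0 < ρ) {χ : Fin d → H2 d}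
    (hχ : ∀ l, SolvesCellProblem A ρ l (χ l)) (k l : Fin d) :
    homogenizedMatrix A χ l k = homogenizedMatrix A χ k l := by
  -- Testing the cell problem for `χ k` with `χ l` turns the corrector contribution into a Hermitian
  -- form in the two correctors. Combined with reality this gives symmetry.
  have hN : ∀ k l, ∑ j, inner ℂ (oneL2 d) (coeffMul hA k j (H2.gradL j (χ l))) =
      -inner ℂ (χ k) (cellOp hA ρ (χ l)) := by
    intro k l
    rw [← inner_cellOp_conj, ((solvesCellProblem_iff_cellOp hA).1 (hχ k)).2, inner_neg_right,
      inner_sum, map_neg, neg_neg, map_sum]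
    refine Finset.sum_congr rfl fun j _ => ?_
    rw [ContinuousLinearMap.adjoint_inner_right, inner_coeffMul_conj]
  rw [← homogenizedMatrix_conj hA hρ hχ l k]
  simp_rw [homogenizedMatrix_eq hA, meanL2_apply, ← Finset.mul_sum, hN, map_add, map_mul,
    Complex.conj_ofReal, map_neg, inner_coeffMul_conj, inner_cellOp_conj]

/-! ### The Hessian of the first eigenvalue -/

/-- The factors `η_j` vanish at the origin, so second derivatives of the `g j` do not enter the
value there. -/
theorem partialEta_partialEta_of_eq_sum {f : EuclideanSpace ℝ (Fin d) → ℝ}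
    {g : Fin d → EuclideanSpace ℝ (Fin d) → ℝ} (hg : ∀ j, ContDiffAt ℝ 2 (g j) 0)
    (hf : ∀ᶠ η in 𝓝 0, f η = ∑ j, η j * g j η) (k l : Fin d) :
    partialEta k (partialEta l f) 0 = partialEta k (g l) 0 + partialEta l (g k) 0 := by
  have hcoord : ∀ (j : Fin d) (η : EuclideanSpace ℝ (Fin d)),
      HasFDerivAt (fun η : EuclideanSpace ℝ (Fin d) => η j)
        (EuclideanSpace.proj j : EuclideanSpace ℝ (Fin d) →L[ℝ] ℝ) η :=
    fun j η => (EuclideanSpace.proj (𝕜 := ℝ) j).hasFDerivAt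
  have hsingle : ∀ i j : Fin d, (EuclideanSpace.proj (𝕜 := ℝ) j)
      (EuclideanSpace.single i (1 : ℝ)) = if j = i then 1 else 0 := by
    intro i j
    simp
  have hdiff : ∀ᶠ η in 𝓝 (0 : EuclideanSpace ℝ (Fin d)), ∀ j, DifferentiableAt ℝ (g j) η := by
    refine Filter.eventually_all.2 fun j => ?_
    filter_upwards [(hg j).eventually (by simp)] with η hη
    exact hη.differentiableAt (by simp)
  have h1 : partialEta l f =ᶠ[𝓝 0] fun η => g l η + ∑ j, η j * partialEta l (g j) η := by
    filter_upwards [hf.eventually_nhds, hdiff] with η hη hd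
    have h2 := HasFDerivAt.fun_sum (u := Finset.univ) fun j _ =>
      (hcoord j η).fun_mul (hd j).hasFDerivAt
    have h3 := (h2.congr_of_eventuallyEq hη).fderiv
    rw [partialEta, h3]
    simp only [sum_apply, add_apply, smul_apply, hsingle, smul_eq_mul,
      Finset.sum_add_distrib, mul_ite, mul_one, mul_zero, Finset.sum_ite_eq', Finset.mem_univ,
      if_true, partialEta]
    ring
  have hpd : ∀ j, DifferentiableAt ℝ (partialEta l (g j)) 0 := by
    intro j
    have h4 : ContDiffAt ℝ 1 (fderiv ℝ (g j)) 0 := (hg j).fderiv_right (by norm_num)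
    exact (h4.differentiableAt (by simp)).clm_apply (differentiableAt_const _)
  have h5 := ((hg l).differentiableAt (by simp)).hasFDerivAt.fun_add
    (HasFDerivAt.fun_sum (u := Finset.univ) fun j _ => (hcoord j 0).fun_mul (hpd j).hasFDerivAt)
  have h6 := (h5.congr_of_eventuallyEq h1).fderiv
  rw [partialEta, h6]
  simp only [sum_apply, add_apply, smul_apply, hsingle, smul_eq_mul,
    mul_ite, mul_one, mul_zero, Finset.sum_ite_eq', Finset.mem_univ, PiLp.zero_apply, zero_mul,
    if_true, zero_add, Finset.sum_add_distrib, Finset.sum_const_zero]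
  rfl

/-- The coefficients of the expansion `a^ρ[η](u, 1) = ∑_j η_j G_j(η, u)`. -/
def fluxCoeff (hA : IsCoefficient A) (ρ : ℝ) (j : Fin d) (η : EuclideanSpace ℝ (Fin d))
    (u : H2 d) : ℂ :=
  -Complex.I * ∑ k, inner ℂ (oneL2 d) (coeffMul hA j k (H2.shiftedGrad η u k)) -
    (ρ : ℂ) ^ 2 * (η j * inner ℂ (oneL2 d) (H2.shiftedLaplacian η u))

/-- Each term carries a factor `η_j` because `(∇ + iη) 1 = iη` and `(∇ + iη)² 1 = -|η|²`. -/
theorem blochForm_one (hA : IsCoefficient A) (η : EuclideanSpace ℝ (Fin d)) (u : H2 d) :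
    blochForm A ρ η u (H2.one d) = ∑ j, (η j : ℂ) * fluxCoeff hA ρ j η u := by
  have h1 : ∀ j, H2.shiftedGrad η (H2.one d) j = (Complex.I * (η j : ℂ)) • oneL2 d := fun j => by
    rw [H2.shiftedGrad_eq, H2.gradL_one, H2.toL2L_one, zero_add]
  have h2 : H2.shiftedLaplacian η (H2.one d) = -(((‖η‖ ^ 2 : ℝ) : ℂ) • oneL2 d) := by
    simp [H2.shiftedLaplacian_eq, H2.gradL_one, H2.laplacianL_one, H2.toL2L_one]
  have h3 : ((‖η‖ ^ 2 : ℝ) : ℂ) = ∑ j, (η j : ℂ) * η j := by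
    rw [EuclideanSpace.real_norm_sq_eq]
    push_cast
    exact Finset.sum_congr rfl fun j _ => sq _
  rw [blochForm_eq hA, h2, coeffForm]
  simp_rw [h1, inner_neg_left, inner_smul_left, Complex.conj_ofReal, h3, fluxCoeff, mul_sub,
    Finset.sum_sub_distrib, map_mul, Complex.conj_I, Complex.conj_ofReal, ← Finset.mul_sum]
  rw [Finset.sum_mul, mul_neg, Finset.mul_sum, ← sub_eq_add_neg]
  congr 1 <;> refine Finset.sum_congr rfl fun j _ => by ring

theorem contDiff_fluxCoeff {n : WithTop ℕ∞} (hA : IsCoefficient A) (j : Fin d) :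
    ContDiff ℝ n fun x : EuclideanSpace ℝ (Fin d) × H2 d => fluxCoeff hA ρ j x.1 x.2 := by
  unfold fluxCoeff
  refine (contDiff_const.mul (ContDiff.sum fun k _ => ?_)).sub
    (contDiff_const.mul ((contDiff_coord contDiff_fst j).mul ?_))
  · exact contDiff_clm (innerSL ℂ (oneL2 d)) (contDiff_clm (coeffMul hA j k)
      (contDiff_shiftedGrad contDiff_fst contDiff_snd k))
  · exact contDiff_clm (innerSL ℂ (oneL2 d)) (contDiff_shiftedLaplacian contDiff_fst contDiff_snd)

/-- The `ρ²` term is a product of two factors vanishing at `0`, so it has zero derivative. In the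
flux term, `-i` cancels the `i` from the shift and the `i` in front of the corrector, leaving the
mean of `A (e_l + ∇χ_l)`. -/
theorem IsFirstBlochEigenfunction.hasDerivAt_fluxCoeff (h : IsFirstBlochEigenfunction A ρ δ φ)
    (hA : IsCoefficient A) (hρ : 0 < ρ) (hδ : 0 < δ) {χ : Fin d → H2 d}
    (hχ : ∀ l, SolvesCellProblem A ρ l (χ l)) (j l : Fin d) :
    HasDerivAt (fun t : ℝ => fluxCoeff hA ρ j (t • EuclideanSpace.single l 1)
      (φ (t • EuclideanSpace.single l 1)))
      (volume.real (cell d) * normConst d * homogenizedMatrix A χ j l) 0 := by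
  have h0 : (0 : EuclideanSpace ℝ (Fin d)) ∈ Metric.ball 0 δ := Metric.mem_ball_self hδ
  obtain ⟨κ, hκ⟩ := h.partialEta_eq hA hρ hδ (hχ l)
  have hu := hasDerivAt_line (h.analytic 0 h0).differentiableAt l
  set e : EuclideanSpace ℝ (Fin d) := EuclideanSpace.single l 1 with he
  have hu0 := h.apply_zero hA hρ hδ
  unfold fluxCoeff
  have h1 := ((HasDerivAt.fun_sum (u := Finset.univ) fun k _ =>
    hasDerivAt_clm (innerSL ℂ (oneL2 d)) (hasDerivAt_clm (coeffMul hA j k)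
      (hasDerivAt_shiftedGrad e hu k))).const_mul (-Complex.I)).fun_sub
    (((hasDerivAt_coord e j 0).fun_mul (hasDerivAt_clm (innerSL ℂ (oneL2 d))
      (hasDerivAt_shiftedLaplacian e hu))).const_mul ((ρ : ℂ) ^ 2))
  refine h1.congr_deriv ?_
  rw [homogenizedMatrix_eq hA]
  simp only [zero_smul, hu0, hκ, shiftedLaplacian_zero, map_add, map_smul, H2.gradL_one,
    H2.laplacianL_one, H2.toL2L_one, smul_zero, add_zero, PiLp.zero_apply, Complex.ofReal_zero,
    map_zero, mul_zero, zero_mul, sub_zero, innerSL_apply_apply, Finset.sum_add_distrib,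
    smul_eq_mul, inner_oneL2]
  have h2 : ∑ k, Complex.I * (e k : ℂ) * ((normConst d : ℂ) * ((volume.real (cell d) : ℂ) *
      meanL2 d (coeffMul hA j k (oneL2 d)))) = Complex.I * ((normConst d : ℂ) *
      ((volume.real (cell d) : ℂ) * meanL2 d (coeffMul hA j l (oneL2 d)))) := by
    rw [Finset.sum_eq_single l]
    · simp [he]
    · intro k _ hk
      simp [he, hk]
    · simp
  rw [h2]
  simp_rw [← Finset.mul_sum]
  ring_nf
  simp only [Complex.I_sq]
  ring

theorem half_partialEta_partialEta_firstBlochEigenvalue (hA : IsCoefficient A) (hρ : 0 < ρ)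
    {χ : Fin d → H2 d} (hχ : ∀ l, SolvesCellProblem A ρ l (χ l)) (k l : Fin d) :
    (((1 / 2 : ℝ) * partialEta k (partialEta l (firstBlochEigenvalue A ρ)) 0 : ℝ) : ℂ) =
      homogenizedMatrix A χ k l := by
  obtain ⟨δ, hδ, -, -, φ, h⟩ := exists_analytic_first_eigenpair hA hρ
  have h0 : (0 : EuclideanSpace ℝ (Fin d)) ∈ Metric.ball 0 δ := Metric.mem_ball_self hδ
  -- This is the inner product of `1` with the normalized eigenfunction, the factor of the
  -- eigenvalue when the equation is tested with `1`.
  set r : ℝ := volume.real (cell d) * normConst d with hr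
  have hr0 : 0 < r := mul_pos (volume_real_cell_pos d) (normConst_pos d)
  set g : Fin d → EuclideanSpace ℝ (Fin d) → ℝ := fun j η => r⁻¹ * (fluxCoeff hA ρ j η (φ η)).re
  have hg : ∀ j, ContDiffAt ℝ 2 (g j) 0 := by
    intro j
    have h1 : ContDiffAt ℝ 2 (fun η => (η, φ η)) (0 : EuclideanSpace ℝ (Fin d)) :=
      contDiffAt_id.prodMk (h.analytic 0 h0).contDiffAt
    have h2 := (contDiff_fluxCoeff (ρ := ρ) (n := 2) hA j).contDiffAt.comp _ h1
    exact contDiffAt_const.mul (Complex.reCLM.contDiff.contDiffAt.comp _ h2)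
  have hf : ∀ᶠ η in 𝓝 0, firstBlochEigenvalue A ρ η = ∑ j, η j * g j η := by
    filter_upwards [Metric.isOpen_ball.mem_nhds h0] with η hη
    have h1 := solvesBloch_iff.1 (h.solves η hη) (H2.one d)
    rw [blochForm_one hA, H2.toL2L_one, inner_oneL2, ← H2.mean_eq, h.mean_eq hη,
      ← Complex.ofReal_mul, ← Complex.ofReal_mul] at h1
    have h2 := congrArg Complex.re h1
    simp only [Complex.re_sum, Complex.re_ofReal_mul, Complex.ofReal_re] at h2
    rw [← hr] at h2
    have h3 : ∑ j, η j * g j η = r⁻¹ * ∑ j, η j * (fluxCoeff hA ρ j η (φ η)).re := by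
      rw [Finset.mul_sum]
      exact Finset.sum_congr rfl fun j _ => by simp only [g]; ring
    rw [h3, h2]
    field_simp
  have hpg : ∀ j l, partialEta l (g j) 0 = (homogenizedMatrix A χ j l).re := by
    intro j l
    have h1 := hasDerivAt_line ((hg j).differentiableAt (by simp)) l
    have h2 := (Complex.reCLM.hasFDerivAt.comp_hasDerivAt 0
      (h.hasDerivAt_fluxCoeff hA hρ hδ hχ j l)).const_mul r⁻¹
    rw [h1.unique h2, ← Complex.ofReal_mul, ← hr, Complex.reCLM_apply, Complex.re_ofReal_mul]
    field_simp
  -- The second derivative is the sum of the `(k, l)` and `(l, k)` entries, equal by symmetry; hence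
  -- the `1/2`.
  rw [partialEta_partialEta_of_eq_sum hg hf, hpg, hpg, homogenizedMatrix_symm hA hρ hχ,
    ← Complex.conj_eq_iff_re.1 (homogenizedMatrix_conj hA hρ hχ k l), Complex.ofReal_re]
  congr 1
  ring

end

end BlochWave

open BlochWave
theorem theorem5p1 {d : ℕ} (A : (Fin d → ℝ) → Matrix (Fin d) (Fin d) ℝ)
    (hA : IsCoefficient A) (ρ : ℝ) (hρ : 0 < ρ) :
    -- the first Bloch eigenvalue and eigenfunction are well defined and analytic near `0`
    (∃ δ : ℝ, 0 < δ ∧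
      (∀ η ∈ Metric.ball (0 : EuclideanSpace ℝ (Fin d)) δ,
        IsLeast (blochEigenvalues A ρ η) (firstBlochEigenvalue A ρ η)) ∧
      AnalyticOnNhd ℝ (firstBlochEigenvalue A ρ) (Metric.ball 0 δ) ∧
      ∃ φ : EuclideanSpace ℝ (Fin d) → H2 d, IsFirstBlochEigenfunction A ρ δ φ) ∧
    firstBlochEigenvalue A ρ 0 = 0 ∧
    (∀ l : Fin d, partialEta l (firstBlochEigenvalue A ρ) 0 = 0) ∧
    -- the correctors exist and are unique
    (∀ l : Fin d, ∃! χ : H2 d, SolvesCellProblem A ρ l χ) ∧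
    ∀ χ : Fin d → H2 d, (∀ l, SolvesCellProblem A ρ l (χ l)) →
      (∀ δ : ℝ, 0 < δ → ∀ φ : EuclideanSpace ℝ (Fin d) → H2 d,
        IsFirstBlochEigenfunction A ρ δ φ →
        ∀ l : Fin d, ∃ c : ℂ, ∀ᵐ y ∂(volume.restrict (cell d)),
          (partialEta l φ 0).toL2 y - Complex.I * (φ 0).toL2 y * (χ l).toL2 y = c) ∧
      ∀ k l : Fin d,
        (((1 / 2 : ℝ) * partialEta k (partialEta l (firstBlochEigenvalue A ρ)) 0 : ℝ) : ℂ) =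
          homogenizedMatrix A χ k l :=
  ⟨exists_analytic_first_eigenpair hA hρ, firstBlochEigenvalue_zero hA,
    partialEta_firstBlochEigenvalue hA, existsUnique_solvesCellProblem hA hρ, fun _ hχ =>
      ⟨fun _ hδ _ h l => h.partialEta_sub_const hA hρ hδ (hχ l),
        half_partialEta_partialEta_firstBlochEigenvalue hA hρ hχ⟩⟩
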